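/- Notation. $\mathbb{R}^{2,2}$ is $\mathbb{R}^4$ with $\langle x,x\rangle=-x_0^2+x_1^2-x_2^2+x_3^2$. Let $\mathcal{A}=\{u+\sigma v:u,v\in\mathbb{R}\}$, $\sigma^2=1$, be the Lorentz numbers and $\mathcal{A}_{\mathbb{C}}=\mathcal{A}\otimes\mathbb{C}$. In the quaternions $\zeta=\zeta_0 1+\zeta_1I+\zeta_2J+\zeta_3K$ with coefficients in $\mathcal{A}_{\mathbb{C}}$ write $\overline{\zeta}$ for the conjugate, $\widehat{\zeta}$ for the image under $\sigma\mapsto-\sigma$, and $H(\zeta,\zeta')=\sum_j\zeta_j\zeta'_j$; let $\mathbb{H}_0=\{p_01+ip_1I+p_2J+ip_3K:p_j\in\mathcal{A}\}$, and identify $x\in\mathbb{R}^{2,2}$ with $\sigma i x_01+x_1I+ix_2J+x_3K$. Let $(M,g)$ be a smooth Lorentzian surface with Levi-Civita connection $\nabla$, and $E\to M$ a smooth vector bundle of rank 2 with a fibre metric of signature $(1,1)$ and a metric connection, also denoted $\nabla$. Assume that $TM$ and $E$ are oriented in space and in time and are given spin structures, with structure groups $Spin''(1,1)=\{\pm(\cosh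 u+i\sinh u\,I):u\in\mathbb{R}\}$ and $Spin'(1,1)=\{\pm(\cosh v+\sigma i\sinh v\,I):v\in\mathbb{R}\}$ respectively (a group element $a$ covers $q\mapsto aq\widehat{a}^{-1}$). A spinorial frame is a pair of points of these two spin bundles over the same point of $M$; it lies over a positively oriented orthonormal frame $(e_0,e_1)$ of $E$, $(e_2,e_3)$ of $TM$ with $|e_0|^2=|e_2|^2=-1$, $|e_1|^2=|e_3|^2=1$. Let $\Sigma=\Sigma E\otimes\Sigma M$ be the twisted spinor bundle: a spinor field $\varphi$ has a coordinate $[\varphi]\in\mathbb{H}_0$ in each spinorial frame, on which the structure group acts by left multiplication, and $X\in E\oplus TM$ with coordinate $[X]\in\mathbb{R}^{2,2}$ acts by $[X\cdot\varphi]=\sigma i[X]\widehat{[\varphi]}$. Endow $\Sigma$ with the spinorial connection $\nabla=\nabla^{\Sigma E}\otimes id+id\otimes\nabla^{\Sigma M}$, with $H(\varphi,\psi)=H([\varphi],[\psi])$, with $\langle\varphi,\psi\rangle$ the coefficient of $1$ in $H(\varphi,\psi)\in\mathcal{A}$, and with $\langle\langle\psi,\psi'\rangle\rangle=\sigma i\,\overline{[\psi']}[\psi]$.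 Let $\vec H$ be a section of $E$ and let $\varphi$ be a smooth section of $\Sigma$ with $$-e_2\cdot\nabla_{e_2}\varphi+e_3\cdot\nabla_{e_3}\varphi=\vec H\cdot\varphi,\qquad H(\varphi,\varphi)=1.$$ Set $\xi(X)=\langle\langle X\cdot\varphi,\varphi\rangle\rangle$ for $X\in E\oplus TM$, and let $F:M\to\mathbb{R}^{2,2}$ satisfy $dF(X)=\xi(X)$ for all $X\in TM$. Then: 1. $F$ is an isometric immersion of $(M,g)$ into $\mathbb{R}^{2,2}$. 2. $\xi$ takes values in $\mathbb{R}^{2,2}$ on $E$, and $\Phi_E:X\in E_m\mapsto(F(m),\xi(X))$ is a smooth bundle map which is an isometry from $E$ onto the normal bundle of the immersion $F$. It preserves the connections: for every section $\nu$ of $E$ and every $X\in TM$, $\xi(\nabla_X\nu)$ is the normal component of the derivative of $\xi(\nu)$ in the direction $X$. It preserves the second fundamental forms: if $B:TM\times TM\to E$ is the bilinear map defined by $\langle B(X,Y),\nu\rangle=-2\langle X\cdot\nabla_Y\varphi,\nu\cdot\varphi\rangle$ for $\nu\in E$, then the second fundamental form of $F$ is $\xi(B(X,Y))$, that is, $\partial_X(dF(Y))=dF(\nabla_XY)+\xi(B(X,Y))$.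 -/

import Mathlib

open Bundle Manifold
open scoped ContDiff Topology

noncomputable section

namespace SpinR22

/-! ### The algebra: Lorentz numbers, quaternions over complexified Lorentz numbers -/

/-- Complexified Lorentz numbers `u + σ v`, `u v : ℂ`, `σ² = 1`; the element `u + σ v` is `⟨u, v⟩`.
The Lorentz numbers `𝒜` are the elements with real `u` and `v`. -/
abbrev AC : Type := QuadraticAlgebra ℂ 1 0

/-- Quaternions `ζ₀ 1 + ζ₁ I + ζ₂ J + ζ₃ K` with coefficients in the complexified Lorentz numbers,
with `I² = J² = K² = -1` and `IJ = -JI = K`. -/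
abbrev HAC : Type := QuaternionAlgebra AC (-1) 0 (-1)

/-- The eight complex coordinates of an element of `HAC`. -/
def coords : HAC →+ (Fin 4 → Fin 2 → ℂ) where
  toFun z := ![![z.re.re, z.re.im], ![z.imI.re, z.imI.im], ![z.imJ.re, z.imJ.im],
    ![z.imK.re, z.imK.im]]
  map_zero' := by ext i j; fin_cases i <;> fin_cases j <;> simp
  map_add' a b := by ext i j; fin_cases i <;> fin_cases j <;> simp

lemma coords_injective : Function.Injective coords := by
  intro a b h
  have h' : ∀ i j, coords a i j = coords b i j := fun i j => by rw [h]
  ext1 <;> ext1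
  · exact h' 0 0
  · exact h' 0 1
  · exact h' 1 0
  · exact h' 1 1
  · exact h' 2 0
  · exact h' 2 1
  · exact h' 3 0
  · exact h' 3 1

/-- `HAC` is a finite-dimensional real vector space; we give it the sup norm of its coordinates
(only the topology and the smooth structure matter). -/
instance : NormedAddCommGroup HAC :=
  NormedAddCommGroup.induced HAC (Fin 4 → Fin 2 → ℂ) coords coords_injective

instance : NormedSpace ℝ HAC where
  norm_smul_le r z := by
    have h : coords (r • z) = r • coords z := by
      ext i j; fin_cases i <;> fin_cases j <;> simp [coords]
    change ‖coords (r • z)‖ ≤ ‖r‖ * ‖coords z‖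
    rw [h, norm_smul]

/-- The involution `u + σ v ↦ u - σ v` of the complexified Lorentz numbers. -/
def hatA (a : AC) : AC := ⟨a.re, -a.im⟩

/-- The involution `ζ ↦ ζ̂`, applied to the four quaternionic coefficients. -/
def hat (z : HAC) : HAC := ⟨hatA z.re, hatA z.imI, hatA z.imJ, hatA z.imK⟩

/-- The `𝒜_ℂ`-bilinear form `H(ζ, ζ') = ζ₀ζ₀' + ζ₁ζ₁' + ζ₂ζ₂' + ζ₃ζ₃'`. -/
def formH (z w : HAC) : AC := z.re * w.re + z.imI * w.imI + z.imJ * w.imJ + z.imK * w.imK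

/-- The Lorentz number `u + σ v` with real `u`, `v`. -/
def lor (u v : ℝ) : AC := ⟨(u : ℂ), (v : ℂ)⟩

/-- The imaginary unit `i` of the complexified Lorentz numbers. -/
def iA : AC := ⟨Complex.I, 0⟩

/-- The element `σ` of the Lorentz numbers. -/
def sigmaA : AC := ⟨0, 1⟩

/-- `ℍ₀ = {p₀ 1 + i p₁ I + p₂ J + i p₃ K : p₀, p₁, p₂, p₃ ∈ 𝒜}`. -/
def H0 : Set HAC :=
  {z | ∃ u v : Fin 4 → ℝ,
    z = ⟨lor (u 0) (v 0), iA * lor (u 1) (v 1), lor (u 2) (v 2), iA * lor (u 3) (v 3)⟩}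

/-- The model `ℝ^{2,2}`: the space `ℝ⁴` (its scalar product is `form22`). -/
abbrev R22 : Type := Fin 4 → ℝ

/-- The scalar product `-x₀y₀ + x₁y₁ - x₂y₂ + x₃y₃` of `ℝ^{2,2}`. -/
def form22 (x y : R22) : ℝ := -(x 0 * y 0) + x 1 * y 1 - x 2 * y 2 + x 3 * y 3

/-- The elements `σi1, I, iJ, K` representing the canonical basis of `ℝ^{2,2}`. -/
def gam : Fin 4 → HAC :=
  ![⟨sigmaA * iA, 0, 0, 0⟩, ⟨0, 1, 0, 0⟩, ⟨0, 0, iA, 0⟩, ⟨0, 0, 0, 1⟩]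

/-- The embedding `ℝ^{2,2} → ℍ₁`, `x ↦ σi x₀ 1 + x₁ I + i x₂ J + x₃ K`. -/
def emb (x : R22) : HAC := ∑ j, x j • gam j

/-- The action on a spinor coordinate of an odd element of the Clifford algebra with coordinate
`q`: `ζ ↦ σ i q ζ̂`. -/
def cliffordOdd (q z : HAC) : HAC := gam 0 * q * hat z

/-- The coordinate in `ℍ₀` of the product of two odd elements with coordinates `q`, `q'`;
it acts on spinor coordinates by left multiplication. -/
def evenProd (q q' : HAC) : HAC := q * hat q'

/-- The `ℍ₁`-valued product `⟨⟨ψ, ψ'⟩⟩ = σ i ξ̄' ξ` in spinor coordinates. -/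
def pairing (z w : HAC) : HAC := gam 0 * star w * z

/-- The real scalar product on spinors, the coefficient of `1` in `H`. -/
def realProd (z w : HAC) : ℝ := (formH z w).re.re

/-! ### The groups `Spin'(1,1)` and `Spin''(1,1)` -/

/-- `cosh v 1 + σ i sinh v I`. -/
def boostE (v : ℝ) : HAC := ⟨lor (Real.cosh v) 0, sigmaA * iA * lor (Real.sinh v) 0, 0, 0⟩

/-- `cosh u 1 + i sinh u I`. -/
def boostM (u : ℝ) : HAC := ⟨lor (Real.cosh u) 0, iA * lor (Real.sinh u) 0, 0, 0⟩

lemma boostE_mul (v w : ℝ) : boostE v * boostE w = boostE (v + w) := by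
  ext <;> simp [boostE, lor, sigmaA, iA, Real.cosh_add, Real.sinh_add] <;> ring_nf
  simp [Complex.I_sq]

lemma boostM_mul (v w : ℝ) : boostM v * boostM w = boostM (v + w) := by
  ext <;> simp [boostM, lor, iA, Real.cosh_add, Real.sinh_add] <;> ring_nf
  simp [Complex.I_sq]

lemma boostE_zero : boostE 0 = 1 := by
  ext <;> simp [boostE, lor, sigmaA, iA] <;> rfl

lemma boostM_zero : boostM 0 = 1 := by
  ext <;> simp [boostM, lor, iA] <;> rfl

/-- `Spin'(1,1) = {±(cosh v 1 + σ i sinh v I)}`, with its multiplication and the topology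
induced by `HAC` (it is closed under inversion: the inverse of `g` is its conjugate). -/
def spinE : Submonoid HAC where
  carrier := {g | ∃ v : ℝ, g = boostE v ∨ g = -boostE v}
  one_mem' := ⟨0, Or.inl boostE_zero.symm⟩
  mul_mem' := by
    rintro a b ⟨v, rfl | rfl⟩ ⟨w, rfl | rfl⟩
    · exact ⟨v + w, Or.inl (boostE_mul v w)⟩
    · exact ⟨v + w, Or.inr (by rw [mul_neg, boostE_mul])⟩
    · exact ⟨v + w, Or.inr (by rw [neg_mul, boostE_mul])⟩
    · exact ⟨v + w, Or.inl (by rw [neg_mul_neg, boostE_mul])⟩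

/-- `Spin''(1,1) = {±(cosh u 1 + i sinh u I)}`, with its multiplication and the topology
induced by `HAC` (it is closed under inversion: the inverse of `g` is its conjugate). -/
def spinM : Submonoid HAC where
  carrier := {g | ∃ v : ℝ, g = boostM v ∨ g = -boostM v}
  one_mem' := ⟨0, Or.inl boostM_zero.symm⟩
  mul_mem' := by
    rintro a b ⟨v, rfl | rfl⟩ ⟨w, rfl | rfl⟩
    · exact ⟨v + w, Or.inl (boostM_mul v w)⟩
    · exact ⟨v + w, Or.inr (by rw [mul_neg, boostM_mul])⟩
    · exact ⟨v + w, Or.inr (by rw [neg_mul, boostM_mul])⟩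
    · exact ⟨v + w, Or.inl (by rw [neg_mul_neg, boostM_mul])⟩

/-! ### Lorentzian bundles of rank two, orientations, spin structures -/

/-- The model space of surfaces and of rank two bundles. -/
abbrev Plane : Type := EuclideanSpace ℝ (Fin 2)

section Bundles

variable {M : Type*} [TopologicalSpace M] [ChartedSpace Plane M]
  (V : M → Type*) [TopologicalSpace (TotalSpace Plane V)]
  [∀ x, AddCommGroup (V x)] [∀ x, Module ℝ (V x)] [∀ x, TopologicalSpace (V x)]
  [∀ x, IsTopologicalAddGroup (V x)] [∀ x, ContinuousSMul ℝ (V x)]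
  [FiberBundle Plane V] [VectorBundle ℝ Plane V]

/-- A smooth fibre metric of signature `(1,1)` on a bundle of rank two. -/
structure LorentzMetric where
  /-- the scalar product of the fibres -/
  val (x : M) : V x →L[ℝ] V x →L[ℝ] ℝ
  symm (x : M) (v w : V x) : val x v w = val x w v
  signature (x : M) : ∃ b : Module.Basis (Fin 2) ℝ (V x),
    val x (b 0) (b 0) = -1 ∧ val x (b 1) (b 1) = 1 ∧ val x (b 0) (b 1) = 0
  contMDiff : ContMDiff (𝓡 2) ((𝓡 2).prod 𝓘(ℝ, Plane →L[ℝ] Plane →L[ℝ] ℝ)) ∞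
    (fun x ↦ TotalSpace.mk' (Plane →L[ℝ] Plane →L[ℝ] ℝ)
      (E := fun x ↦ V x →L[ℝ] V x →L[ℝ] ℝ) x (val x))

variable {V}

/-- Positively oriented orthonormal basis `(f 0, f 1)` of the fibre at `x`: `f 0` is timelike and
future-directed, `f 1` is spacelike, and the basis has the given orientation. -/
def IsPositiveFrame (g : LorentzMetric V) {x : M} (o : Orientation ℝ (V x) (Fin 2))
    (future : Set (V x)) (f : Fin 2 → V x) : Prop :=
  g.val x (f 0) (f 0) = -1 ∧ g.val x (f 1) (f 1) = 1 ∧ g.val x (f 0) (f 1) = 0 ∧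
    f 0 ∈ future ∧ ∃ b : Module.Basis (Fin 2) ℝ (V x), ⇑b = f ∧ b.orientation = o

/-- An orientation in space and in time: an orientation of the fibres and a distinguished
component of the timelike vectors of each fibre, both varying continuously (that is, near each
point there is a smooth frame which is positively oriented for both). -/
structure SpaceTimeOrientation (g : LorentzMetric V) where
  /-- the orientation of the fibres -/
  orient (x : M) : Orientation ℝ (V x) (Fin 2)
  /-- the future-directed timelike vectors -/
  future (x : M) : Set (V x)
  future_eq (x : M) : ∃ t : V x, g.val x t t < 0 ∧
    future x = connectedComponentIn {v : V x | g.val x v v < 0} t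
  locally_frame (x₀ : M) : ∃ U : Set M, IsOpen U ∧ x₀ ∈ U ∧ ∃ f : Fin 2 → (x : M) → V x,
    (∀ i, ContMDiffOn (𝓡 2) ((𝓡 2).prod 𝓘(ℝ, Plane)) ∞
      (fun x ↦ TotalSpace.mk' Plane x (f i x)) U) ∧
    ∀ x ∈ U, IsPositiveFrame g (orient x) (future x) (fun i ↦ f i x)

/-- The quaternionic coordinate of the vector `v` in an orthonormal frame `(f 0, f 1)` whose
vectors are represented by `c₀` and `c₁`. -/
def vecCoord (g : LorentzMetric V) (c₀ c₁ : HAC) {x : M} (f : Fin 2 → V x) (v : V x) : HAC :=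
  (-(g.val x v (f 0))) • c₀ + (g.val x v (f 1)) • c₁

/-- A spin structure on a rank two Lorentzian bundle, oriented in space and in time: a principal
bundle `P` with structure group `G` (acting on the right, by right translations in the
trivializations), with a continuous map to the bundle of positively oriented orthonormal frames
which is equivariant along the double cover `q ↦ g q ĝ⁻¹`; here the plane spanned by `c₀, c₁`
represents the standard Lorentzian plane. For `g` in the spin groups, `ĝ⁻¹` is the conjugate
of `ĝ`. -/
structure SpinStructure (G : Submonoid HAC) (c₀ c₁ : HAC) {g : LorentzMetric V}
    (o : SpaceTimeOrientation g)
    (P : M → Type*) [TopologicalSpace (TotalSpace G P)] [∀ x, TopologicalSpace (P x)]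
    [FiberBundle G P] where
  /-- the right action of the structure group -/
  act {x : M} (p : P x) (a : G) : P x
  trivialization_act (e : Trivialization G (π G P)) (_ : e ∈ FiberBundle.trivializationAtlas G P)
    (x : M) (_ : x ∈ e.baseSet) (p : P x) (a : G) :
    (e (TotalSpace.mk' G x (act p a))).2 = (e (TotalSpace.mk' G x p)).2 * a
  /-- the orthonormal frame below a spinorial frame -/
  frame {x : M} (p : P x) : Fin 2 → V x
  frame_positive {x : M} (p : P x) : IsPositiveFrame g (o.orient x) (o.future x) (frame p)
  frame_continuous (i : Fin 2) :
    Continuous (fun p : TotalSpace G P ↦ TotalSpace.mk' Plane p.1 (frame p.2 i))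
  frame_act {x : M} (p : P x) (a : G) (v : V x) :
    vecCoord g c₀ c₁ (frame p) v =
      (a : HAC) * vecCoord g c₀ c₁ (frame (act p a)) v * star (hat (a : HAC))

/-- A local section `s` over the open set `U` of the principal bundle of a spin structure, which is
smooth, i.e. continuous and such that the frame below it is smooth (the principal bundle covers the
bundle of orthonormal frames, and carries the smooth structure for which the covering is a local
diffeomorphism). -/
structure IsLocalSpinFrame {G : Submonoid HAC} {c₀ c₁ : HAC} {g : LorentzMetric V}
    {o : SpaceTimeOrientation g}
    {P : M → Type*} [TopologicalSpace (TotalSpace G P)] [∀ x, TopologicalSpace (P x)]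
    [FiberBundle G P] (S : SpinStructure G c₀ c₁ o P) (U : Set M) (s : (x : M) → P x) : Prop where
  isOpen : IsOpen U
  continuousOn : ContinuousOn (fun x ↦ TotalSpace.mk' G x (s x)) U
  contMDiffOn (i : Fin 2) : ContMDiffOn (𝓡 2) ((𝓡 2).prod 𝓘(ℝ, Plane)) ∞
    (fun x ↦ TotalSpace.mk' Plane x (S.frame (s x) i)) U

/-- A connection is compatible with the metric: `X⟨v, w⟩ = ⟨∇_X v, w⟩ + ⟨v, ∇_X w⟩`. -/
def IsMetricConnection (g : LorentzMetric V) (cov : CovariantDerivative (𝓡 2) Plane V) : Prop :=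
  ∀ (v w : (x : M) → V x) (x : M),
    MDifferentiableAt (𝓡 2) ((𝓡 2).prod 𝓘(ℝ, Plane)) (fun y ↦ TotalSpace.mk' Plane y (v y)) x →
    MDifferentiableAt (𝓡 2) ((𝓡 2).prod 𝓘(ℝ, Plane)) (fun y ↦ TotalSpace.mk' Plane y (w y)) x →
    ∀ X : TangentSpace (𝓡 2) x,
      mfderiv (𝓡 2) 𝓘(ℝ, ℝ) (fun y ↦ g.val y (v y) (w y)) x X =
        g.val x (cov v x X) (w x) + g.val x (v x) (cov w x X)

end Bundles

/-! ### The geometric data -/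

section Surface

variable {M : Type*} [TopologicalSpace M] [ChartedSpace Plane M] [IsManifold (𝓡 2) ∞ M]

/-- `cov` is the Levi-Civita connection of the Lorentzian metric `g`. -/
def IsLeviCivita (g : LorentzMetric (TangentSpace (𝓡 2) : M → Type _))
    (cov : CovariantDerivative (𝓡 2) Plane (TangentSpace (𝓡 2) : M → Type _)) : Prop :=
  IsMetricConnection g cov ∧
  ∀ (X Y : (x : M) → TangentSpace (𝓡 2) x) (x : M),
    MDifferentiableAt (𝓡 2) ((𝓡 2).prod 𝓘(ℝ, Plane)) (fun y ↦ TotalSpace.mk' Plane y (X y)) x →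
    MDifferentiableAt (𝓡 2) ((𝓡 2).prod 𝓘(ℝ, Plane)) (fun y ↦ TotalSpace.mk' Plane y (Y y)) x →
      cov Y x (X x) - cov X x (Y x) = VectorField.mlieBracket (𝓡 2) X Y x

variable {E : M → Type*} [TopologicalSpace (TotalSpace Plane E)]
  [∀ x, AddCommGroup (E x)] [∀ x, Module ℝ (E x)] [∀ x, TopologicalSpace (E x)]
  [∀ x, IsTopologicalAddGroup (E x)] [∀ x, ContinuousSMul ℝ (E x)]
  [FiberBundle Plane E] [VectorBundle ℝ Plane E]
  {g : LorentzMetric (TangentSpace (𝓡 2) : M → Type _)} {h : LorentzMetric E}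
  {oM : SpaceTimeOrientation g} {oE : SpaceTimeOrientation h}
  {PE : M → Type*} [TopologicalSpace (TotalSpace spinE PE)] [∀ x, TopologicalSpace (PE x)]
  [FiberBundle spinE PE]
  {PM : M → Type*} [TopologicalSpace (TotalSpace spinM PM)] [∀ x, TopologicalSpace (PM x)]
  [FiberBundle spinM PM]

/-- A smooth section of the twisted spinor bundle `Σ = ΣE ⊗ ΣM`, the bundle associated to the
principal bundle `PE ×_M PM` and to the representation `(g₁, g₂) ↦ (ξ ↦ g₁ g₂ ξ)` on `ℍ₀`: the
section is given by its coordinate in `ℍ₀` in each spinorial frame `(p, q)`. -/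
structure SpinorField (SE : SpinStructure spinE (gam 0) (gam 1) oE PE)
    (SM : SpinStructure spinM (gam 2) (gam 3) oM PM) where
  /-- the coordinate of the spinor field in a spinorial frame -/
  coord {x : M} (p : PE x) (q : PM x) : HAC
  mem_H0 {x : M} (p : PE x) (q : PM x) : coord p q ∈ H0
  equivariant {x : M} (p : PE x) (q : PM x) (a : spinE) (b : spinM) :
    coord p q = (a : HAC) * (b : HAC) * coord (SE.act p a) (SM.act q b)
  contMDiffOn (U : Set M) (s : (x : M) → PE x) (t : (x : M) → PM x)
    (_ : IsLocalSpinFrame SE U s) (_ : IsLocalSpinFrame SM U t) :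
    ContMDiffOn (𝓡 2) 𝓘(ℝ, HAC) ∞ (fun x ↦ coord (s x) (t x)) U

variable {SE : SpinStructure spinE (gam 0) (gam 1) oE PE}
  {SM : SpinStructure spinM (gam 2) (gam 3) oM PM}

/-- The coordinate in `ℍ₁` of the vector `ν + X` of `E ⊕ TM` in the spinorial frame `(p, q)`. -/
def oddCoord (SE : SpinStructure spinE (gam 0) (gam 1) oE PE)
    (SM : SpinStructure spinM (gam 2) (gam 3) oM PM) {x : M} (p : PE x) (q : PM x)
    (ν : E x) (X : TangentSpace (𝓡 2) x) : HAC :=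
  vecCoord h (gam 0) (gam 1) (SE.frame p) ν + vecCoord g (gam 2) (gam 3) (SM.frame q) X

/-- The form `ξ(ν + X) = ⟨⟨(ν + X) · φ, φ⟩⟩`, for `ν + X` in `E ⊕ TM`, computed in the spinorial
frame `(p, q)`. By the equivariance of `φ` and of the frames it does not depend on `(p, q)`. -/
def SpinorField.xi (φ : SpinorField SE SM) {x : M} (p : PE x) (q : PM x)
    (ν : E x) (X : TangentSpace (𝓡 2) x) : HAC :=
  pairing (cliffordOdd (oddCoord SE SM p q ν X) (φ.coord p q)) (φ.coord p q)

/-- The connection form `X ↦ ⟨∇_X f₀, f₁⟩` of a connection in the orthonormal frame `(f₀, f₁)`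
below a local section of a spin structure. -/
def connForm {V : M → Type*} [TopologicalSpace (TotalSpace Plane V)]
    [∀ x, AddCommGroup (V x)] [∀ x, Module ℝ (V x)] [∀ x, TopologicalSpace (V x)]
    [∀ x, IsTopologicalAddGroup (V x)] [∀ x, ContinuousSMul ℝ (V x)]
    [FiberBundle Plane V] [VectorBundle ℝ Plane V] {k : LorentzMetric V}
    {o : SpaceTimeOrientation k} {G : Submonoid HAC} {c₀ c₁ : HAC}
    {P : M → Type*} [TopologicalSpace (TotalSpace G P)] [∀ x, TopologicalSpace (P x)]
    [FiberBundle G P] (S : SpinStructure G c₀ c₁ o P) (cov : CovariantDerivative (𝓡 2) Plane V)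
    (s : (x : M) → P x) (x : M) (X : TangentSpace (𝓡 2) x) : ℝ :=
  k.val x (cov (fun y ↦ S.frame (s y) 0) x X) (S.frame (s x) 1)

/-- The coordinate, in the local spinorial frame `(s, t)`, of the spinorial covariant derivative
`∇_X φ`, where `∇ = ∇^{ΣE} ⊗ id + id ⊗ ∇^{ΣM}`:
`X[φ] + ½ ε₀ε₁ ⟨∇_X e₀, e₁⟩ e₀·e₁·[φ] + ½ ε₂ε₃ ⟨∇_X e₂, e₃⟩ e₂·e₃·[φ]`, where
`ε₀ε₁ = ε₂ε₃ = -1`. -/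
def SpinorField.nabla (φ : SpinorField SE SM) (covE : CovariantDerivative (𝓡 2) Plane E)
    (covM : CovariantDerivative (𝓡 2) Plane (TangentSpace (𝓡 2) : M → Type _))
    (s : (x : M) → PE x) (t : (x : M) → PM x) (x : M) (X : TangentSpace (𝓡 2) x) : HAC :=
  (show HAC from mfderiv (𝓡 2) 𝓘(ℝ, HAC) (fun y ↦ φ.coord (s y) (t y)) x X)
    - (connForm SE covE s x X / 2) • (evenProd (gam 0) (gam 1) * φ.coord (s x) (t x))
    - (connForm SM covM t x X / 2) • (evenProd (gam 2) (gam 3) * φ.coord (s x) (t x))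

/-- The Dirac equation `Dφ = H⃗ · φ`, where `Dφ = -e₂ · ∇_{e₂} φ + e₃ · ∇_{e₃} φ`. -/
def SpinorField.IsDiracSolution (φ : SpinorField SE SM)
    (covE : CovariantDerivative (𝓡 2) Plane E)
    (covM : CovariantDerivative (𝓡 2) Plane (TangentSpace (𝓡 2) : M → Type _))
    (Hvec : (x : M) → E x) : Prop :=
  ∀ (U : Set M) (s : (x : M) → PE x) (t : (x : M) → PM x),
    IsLocalSpinFrame SE U s → IsLocalSpinFrame SM U t → ∀ x ∈ U,
    -cliffordOdd (gam 2) (φ.nabla covE covM s t x (SM.frame (t x) 0))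
      + cliffordOdd (gam 3) (φ.nabla covE covM s t x (SM.frame (t x) 1))
      = cliffordOdd (oddCoord SE SM (s x) (t x) (Hvec x) 0) (φ.coord (s x) (t x))

/-- The normalization `H(φ, φ) = 1`. -/
def SpinorField.IsNormalized (φ : SpinorField SE SM) : Prop :=
  ∀ (x : M) (p : PE x) (q : PM x), formH (φ.coord p q) (φ.coord p q) = 1

/-- `B : TM × TM → E` is the bilinear map associated to `φ`:
`⟨B(X, Y), ν⟩ = -2 ⟨X · ∇_Y φ, ν · φ⟩`. -/
def SpinorField.IsSecondFundamentalForm (φ : SpinorField SE SM)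
    (covE : CovariantDerivative (𝓡 2) Plane E)
    (covM : CovariantDerivative (𝓡 2) Plane (TangentSpace (𝓡 2) : M → Type _))
    (B : (x : M) → TangentSpace (𝓡 2) x →L[ℝ] TangentSpace (𝓡 2) x →L[ℝ] E x) : Prop :=
  ∀ (U : Set M) (s : (x : M) → PE x) (t : (x : M) → PM x),
    IsLocalSpinFrame SE U s → IsLocalSpinFrame SM U t → ∀ x ∈ U,
    ∀ (X Y : TangentSpace (𝓡 2) x) (ν : E x),
      h.val x (B x X Y) ν =
        -2 * realProd
          (cliffordOdd (oddCoord SE SM (s x) (t x) 0 X) (φ.nabla covE covM s t x Y))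
          (cliffordOdd (oddCoord SE SM (s x) (t x) ν 0) (φ.coord (s x) (t x)))

/-! ### Immersed surfaces in `ℝ^{2,2}` -/

/-- The differential of `F : M → ℝ^{2,2}` at `x`, as a linear map to `ℝ^{2,2}`. -/
def diff (F : M → R22) (x : M) : TangentSpace (𝓡 2) x →L[ℝ] R22 :=
  mfderiv (𝓡 2) 𝓘(ℝ, R22) F x

/-- The normal space of the immersion `F` at `x`: the orthogonal of `dF(T_x M)` in `ℝ^{2,2}`. -/
def normalSpace (F : M → R22) (x : M) : Set R22 :=
  {w | ∀ X : TangentSpace (𝓡 2) x, form22 w (diff F x X) = 0}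

/-- `n` is the normal component of `w ∈ ℝ^{2,2}`, along the immersion `F`, at `x`. -/
def IsNormalPart (F : M → R22) (x : M) (w n : R22) : Prop :=
  n ∈ normalSpace F x ∧ ∃ Y : TangentSpace (𝓡 2) x, w = diff F x Y + n

/-- An isometric immersion of `(M, g)` into `ℝ^{2,2}`. -/
def IsIsometricImmersion (g : LorentzMetric (TangentSpace (𝓡 2) : M → Type _))
    (F : M → R22) : Prop :=
  ContMDiff (𝓡 2) 𝓘(ℝ, R22) ∞ F ∧ ∀ x, Function.Injective (diff F x) ∧
    ∀ X Y : TangentSpace (𝓡 2) x, form22 (diff F x X) (diff F x Y) = g.val x X Y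

end Surface

end SpinR22

end

noncomputable section

namespace SpinR22

/-! ### Involutions of the quaternion algebra -/

section Algebra

/-! In a spinorial frame, with ζ the coordinate of φ, the form is ξ(q) = -ζ̄ q ζ̂. The normalization
reads ζ̄ζ = 1 and H is multiplicative, so ξ preserves H (`formH_xiQ`). It also preserves the two
reality conditions that cut ℝ^{2,2} out of the quaternions (`emb_toR22_xiQ`), and it is inverted by
the form attached to ζ̄ (`exists_xiQ_eq_emb`). At each point ξ is therefore a linear isometry of E ⊕
TM onto ℝ^{2,2}. This already makes F an isometric immersion and ξ an isometry from E onto the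
normal bundle, without the Dirac equation.

The spinorial connection lifts the connections of E and TM, so ∂_Z ξ(V) equals ξ(∇_Z V) plus the two
terms in which one factor φ is replaced by ∇_Z φ (`SpinorField.vderiv_xi`). Write ∇_Z φ = ηφ. Since
H(φ, φ) is constant, η is purely imaginary, and the extra terms add up to ξ(q η̂ - η q)
(`xiQ_variation`). The I component of η acts by infinitesimal boosts inside E and inside TM, while
its J and K components exchange E and TM (`quatJK_tangent`, `quatJK_normal`).

The Dirac equation says exactly what is needed about η (`exists_quatJK_of_dirac`): the I components
vanish, and the eight remaining real parameters satisfy two linear relations. Six parameters are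
left, those of a symmetric bilinear map from TM × TM to E. Vanishing of the I component gives the
preservation of the connections; the symmetric map is B, and it is the second fundamental form of F.

The rest is analytic: smooth spinorial frames exist locally
(`SpinStructure.exists_isLocalSpinFrame`), ξ is independent of the frame (`SpinorField.xi_congr`),
and F is smooth because its differential is (`contMDiff_of_vderiv`). -/

lemma hatA_add (a b : AC) : hatA (a + b) = hatA a + hatA b := by
  ext <;> simp [hatA]; ring

lemma hatA_neg (a : AC) : hatA (-a) = -hatA a := by
  ext <;> simp [hatA]

lemma hatA_mul (a b : AC) : hatA (a * b) = hatA a * hatA b := by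
  ext <;> simp [hatA]; ring

lemma hat_add (z w : HAC) : hat (z + w) = hat z + hat w := by
  ext1 <;> simp [hat, hatA_add]

lemma hat_neg (z : HAC) : hat (-z) = -hat z := by
  ext1 <;> simp [hat, hatA_neg]

lemma hat_mul (z w : HAC) : hat (z * w) = hat z * hat w := by
  ext1 <;> simp [hat, hatA_mul, hatA_add, hatA_neg, sub_eq_add_neg]

lemma hat_hat (z : HAC) : hat (hat z) = z := by
  ext <;> simp [hat, hatA]

lemma hat_smul (r : ℝ) (z : HAC) : hat (r • z) = r • hat z := by
  ext <;> simp [hat, hatA]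

lemma star_hat (z : HAC) : star (hat z) = hat (star z) := by
  ext1 <;> simp [hat, hatA_neg]

lemma star_real_smul (r : ℝ) (z : HAC) : star (r • z) = r • star z := by
  ext1 <;> simp

/-- Complex conjugation of complexified Lorentz numbers. -/
def conjA (a : AC) : AC := ⟨starRingEnd ℂ a.re, starRingEnd ℂ a.im⟩

lemma conjA_add (a b : AC) : conjA (a + b) = conjA a + conjA b := by
  ext1 <;> simp [conjA]

lemma conjA_neg (a : AC) : conjA (-a) = -conjA a := by
  ext1 <;> simp [conjA]

lemma conjA_mul (a b : AC) : conjA (a * b) = conjA a * conjA b := by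
  ext1 <;> simp [conjA]

/-- The conjugate-linear automorphism of `HAC` whose fixed points are the elements of `ℍ₀`. -/
def tau (z : HAC) : HAC := ⟨conjA z.re, -conjA z.imI, conjA z.imJ, -conjA z.imK⟩

lemma tau_add (z w : HAC) : tau (z + w) = tau z + tau w := by
  ext1 <;> simp [tau, conjA_add] <;> ring

lemma tau_neg (z : HAC) : tau (-z) = -tau z := by
  ext1 <;> simp [tau, conjA_neg]

lemma tau_mul (z w : HAC) : tau (z * w) = tau z * tau w := by
  ext1 <;> simp [tau, conjA_mul, conjA_add, conjA_neg, sub_eq_add_neg] <;> ring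

lemma tau_smul (r : ℝ) (z : HAC) : tau (r • z) = r • tau z := by
  ext <;> simp [tau, conjA]

lemma tau_star (z : HAC) : tau (star z) = star (tau z) := by
  ext1 <;> simp [tau, conjA_neg]

lemma tau_hat (z : HAC) : tau (hat z) = hat (tau z) := by
  ext <;> simp [tau, hat, conjA, hatA]

lemma tau_eq_of_mem_H0 {z : HAC} (hz : z ∈ H0) : tau z = z := by
  obtain ⟨u, v, rfl⟩ := hz
  ext <;> simp [tau, conjA, lor, iA]

/-- A complexified quaternion fixed by `tau`, purely imaginary, in real coordinates. -/
lemma exists_coords_of_tau_star {z : HAC} (h₁ : tau z = z) (h₂ : star z = -z) :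
    ∃ a a' b b' c c' : ℝ, z = ⟨0, iA * lor a a', lor b b', iA * lor c c'⟩ := by
  have e := fun f : HAC → ℝ => congrArg f h₁
  refine ⟨z.imI.re.im, z.imI.im.im, z.imJ.re.re, z.imJ.im.re, z.imK.re.im, z.imK.im.im, ?_⟩
  have r := congrArg QuaternionAlgebra.re h₂
  have r₁ := congrArg QuadraticAlgebra.re r
  have r₂ := congrArg QuadraticAlgebra.im r
  have e₁ := e (fun w => w.imI.re.re)
  have e₂ := e (fun w => w.imI.im.re)
  have e₃ := e (fun w => w.imJ.re.im)
  have e₄ := e (fun w => w.imJ.im.im)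
  have e₅ := e (fun w => w.imK.re.re)
  have e₆ := e (fun w => w.imK.im.re)
  simp [tau, conjA] at e₁ e₂ e₃ e₄ e₅ e₆ r₁ r₂
  ext1 <;> ext1 <;> apply Complex.ext <;> simp [lor, iA]
  all_goals first | linarith | skip
  all_goals simp [Complex.ext_iff] at r₁ r₂
  all_goals linarith [r₁.1, r₁.2, r₂.1, r₂.2]

/-! ### Vectors of `ℝ^{2,2}` as quaternions -/

lemma emb_eq (x : R22) : emb x =
    ⟨⟨0, x 0 * Complex.I⟩, ⟨x 1, 0⟩, ⟨x 2 * Complex.I, 0⟩, ⟨x 3, 0⟩⟩ := by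
  simp only [emb, Fin.sum_univ_four, gam]
  ext <;> simp [sigmaA, iA, QuadraticAlgebra.re_one, QuadraticAlgebra.im_one]

/-- The real coordinates of a quaternion along `σi1, I, iJ, K`. -/
def toR22 : HAC →ₗ[ℝ] R22 where
  toFun z := ![z.re.im.im, z.imI.re.re, z.imJ.re.im, z.imK.re.re]
  map_add' z w := by ext i; fin_cases i <;> simp
  map_smul' r z := by ext i; fin_cases i <;> simp

lemma toR22_emb (x : R22) : toR22 (emb x) = x := by
  rw [emb_eq]; ext i; fin_cases i <;> simp [toR22]

lemma tau_emb (x : R22) : tau (emb x) = -emb x := by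
  rw [emb_eq]; ext <;> simp [tau, conjA]

lemma star_hat_emb (x : R22) : star (hat (emb x)) = -emb x := by
  rw [emb_eq]; ext <;> simp [hat, hatA]

/-- The two conditions are linear over ℝ and cut out exactly the image of `emb`. In this form
membership in ℝ^{2,2} can be checked through the multiplicative behaviour of `tau`, `star` and
`hat`, without expanding coordinates. -/
lemma emb_toR22 {w : HAC} (h₁ : tau w = -w) (h₂ : star (hat w) = -w) : emb (toR22 w) = w := by
  have e := fun f : HAC → ℝ => congrArg f h₁
  have d := fun f : HAC → ℝ => congrArg f h₂
  have e₁ := e (fun w => w.re.im.re)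
  have e₂ := e (fun w => w.imI.re.im)
  have e₃ := e (fun w => w.imJ.re.re)
  have e₄ := e (fun w => w.imK.re.im)
  have d₁ := d (fun w => w.re.re.re)
  have d₂ := d (fun w => w.re.re.im)
  have d₃ := d (fun w => w.imI.im.re)
  have d₄ := d (fun w => w.imI.im.im)
  have d₅ := d (fun w => w.imJ.im.re)
  have d₆ := d (fun w => w.imJ.im.im)
  have d₇ := d (fun w => w.imK.im.re)
  have d₈ := d (fun w => w.imK.im.im)
  simp [tau, conjA, hat, hatA] at e₁ e₂ e₃ e₄ d₁ d₂ d₃ d₄ d₅ d₆ d₇ d₈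
  rw [emb_eq]
  ext1 <;> ext1 <;> apply Complex.ext <;> simp [toR22] <;> linarith

lemma formH_emb (x y : R22) : formH (emb x) (emb y) = lor (form22 x y) 0 := by
  rw [emb_eq, emb_eq]
  ext1 <;> apply Complex.ext <;> simp [formH, lor, form22]
  all_goals ring

lemma realProd_emb (x y : R22) : realProd (emb x) (emb y) = form22 x y := by
  simp [realProd, formH_emb, lor]

/-- Polarization of the multiplicativity of the quaternionic norm, valid over any commutative ring
of coefficients. -/
lemma formH_mul_left (a z w : HAC) : formH (a * z) (a * w) = formH a a * formH z w := by
  simp [formH]; ring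

lemma formH_mul_right (a z w : HAC) : formH (z * a) (w * a) = formH a a * formH z w := by
  simp [formH]; ring

lemma formH_star (z w : HAC) : formH (star z) (star w) = formH z w := by
  simp [formH]

lemma formH_neg_neg (z w : HAC) : formH (-z) (-w) = formH z w := by
  simp [formH]

lemma formH_hat (z w : HAC) : formH (hat z) (hat w) = hatA (formH z w) := by
  simp [formH, hat, hatA_add, hatA_mul]

lemma star_mul_self_eq_one {z : HAC} (h : formH z z = 1) : star z * z = 1 := by
  ext1
  · exact Eq.trans (by simp [formH]) h
  all_goals simp; ring

lemma self_mul_star_eq_one {z : HAC} (h : formH z z = 1) : z * star z = 1 := by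
  ext1
  · exact Eq.trans (by simp [formH]) h
  all_goals simp; ring

/-! ### The form ξ on coordinates: reality, isometry, surjectivity, variation. -/

lemma gam_zero_mul_gam_zero : gam 0 * gam 0 = -1 := by
  ext <;> simp [gam, sigmaA, iA, QuadraticAlgebra.re_one, QuadraticAlgebra.im_one]

lemma gam_zero_comm (z : HAC) : z * gam 0 = gam 0 * z := by
  ext1 <;> simp [gam] <;> ring

/-- `ξ(q) = -ζ̄ q ζ̂`, where `ζ` is the coordinate of the spinor and `q` the one of the vector. -/
def xiQ (z q : HAC) : HAC := -(star z * q * hat z)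

/-- The element σi is a central scalar of square -1, so the two factors σi of the pairing and of the
Clifford action merge into the sign of `xiQ`. -/
lemma pairing_cliffordOdd (z q : HAC) : pairing (cliffordOdd q z) z = xiQ z q := by
  have : pairing (cliffordOdd q z) z = gam 0 * (star z * gam 0) * q * hat z := by
    simp [pairing, cliffordOdd, mul_assoc]
  rw [this, gam_zero_comm, ← mul_assoc, gam_zero_mul_gam_zero]
  simp [xiQ]

lemma xiQ_add (z q q' : HAC) : xiQ z (q + q') = xiQ z q + xiQ z q' := by
  simp [xiQ, mul_add, add_mul]; abel

lemma xiQ_smul (r : ℝ) (z q : HAC) : xiQ z (r • q) = r • xiQ z q := by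
  simp [xiQ]

/-- Both conditions of `emb_toR22` pass from q to ζ̄ q ζ̂. The map `tau` is a ring automorphism
commuting with `star` and `hat` and fixing ζ; the composite of `star` and `hat` reverses products
and sends the right factor ζ̂ to ζ̄ and the left factor ζ̄ to ζ̂. -/
lemma emb_toR22_xiQ {z : HAC} (h : tau z = z) (x : R22) :
    emb (toR22 (xiQ z (emb x))) = xiQ z (emb x) := by
  apply emb_toR22
  · rw [xiQ, tau_neg, tau_mul, tau_mul, tau_star, tau_hat, h, tau_emb]; simp
  · have := star_hat_emb x
    rw [xiQ, hat_neg, hat_mul, hat_mul, hat_hat, star_neg, star_mul, star_mul, this, ← star_hat,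
      star_star]
    simp [mul_assoc]

lemma formH_hat_self {z : HAC} (h : formH z z = 1) : formH (hat z) (hat z) = 1 := by
  rw [formH_hat, h]; ext <;> simp [hatA, QuadraticAlgebra.im_one]

lemma formH_xiQ {z : HAC} (h : formH z z = 1) (q q' : HAC) :
    formH (xiQ z q) (xiQ z q') = formH q q' := by
  rw [xiQ, xiQ, formH_neg_neg, formH_mul_right, formH_mul_left, formH_hat_self h, formH_star, h,
    one_mul, one_mul]

/-- The form attached to ζ̄ inverts the one attached to ζ, because ζ and ζ̂ both have unit norm; the
two minus signs cancel. -/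
lemma exists_xiQ_eq_emb {z : HAC} (hz : formH z z = 1) (hτ : tau z = z) (w : R22) :
    ∃ x : R22, xiQ z (emb x) = emb w := by
  refine ⟨toR22 (xiQ (star z) (emb w)), ?_⟩
  rw [emb_toR22_xiQ (by rw [tau_star, hτ])]
  have h₁ := star_mul_self_eq_one hz
  have h₂ := star_mul_self_eq_one (formH_hat_self hz)
  simp only [xiQ, star_star, mul_neg, neg_mul, neg_neg, ← star_hat]
  rw [← mul_assoc, ← mul_assoc, h₁, one_mul, mul_assoc, h₂, mul_one]

/-- If the spinor changes by `η ζ`, then `ξ(q)` changes by `ξ(q η̂ - η q)`, for `η` purely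
imaginary. -/
lemma xiQ_variation {z e : HAC} (q : HAC) (he : star e = -e) :
    -(star (e * z) * q * hat z + star z * q * hat (e * z)) = xiQ z (q * hat e - e * q) := by
  simp only [xiQ, star_mul, he, hat_mul]
  noncomm_ring

end Algebra

/-! ### The pointwise algebra of the Dirac equation -/

section Dirac

/-- The quaternion `b J + i c K`, with `b = b₀ + σ b₁` and `c = c₀ + σ c₁`. -/
def quatJK (b₀ b₁ c₀ c₁ : ℝ) : HAC := ⟨0, 0, lor b₀ b₁, iA * lor c₀ c₁⟩

lemma star_quatJK (b₀ b₁ c₀ c₁ : ℝ) : star (quatJK b₀ b₁ c₀ c₁) = -quatJK b₀ b₁ c₀ c₁ := by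
  ext1 <;> simp [quatJK]

lemma quatJK_smul_add (r s b₀ b₁ c₀ c₁ b₀' b₁' c₀' c₁' : ℝ) :
    r • quatJK b₀ b₁ c₀ c₁ + s • quatJK b₀' b₁' c₀' c₁' =
      quatJK (r * b₀ + s * b₀') (r * b₁ + s * b₁') (r * c₀ + s * c₀') (r * c₁ + s * c₁') := by
  ext <;> simp [quatJK, lor, iA]
  all_goals ring

/-- The J and K components exchange the two planes. Here a tangent vector gives a normal one, which
is the second fundamental form; in `quatJK_normal` a normal vector gives a tangent one, which is the
shape operator. -/
lemma quatJK_tangent (x₂ x₃ b₀ b₁ c₀ c₁ : ℝ) :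
    (x₂ • gam 2 + x₃ • gam 3) * hat (quatJK b₀ b₁ c₀ c₁)
        - quatJK b₀ b₁ c₀ c₁ * (x₂ • gam 2 + x₃ • gam 3) =
      (2 * (x₂ * b₁ + x₃ * c₁)) • gam 0 + (-2 * (x₂ * c₀ + x₃ * b₀)) • gam 1 := by
  ext <;> apply Complex.ext <;> simp [quatJK, lor, iA, gam, hat, hatA, sigmaA,
    QuadraticAlgebra.re_one, QuadraticAlgebra.im_one]
  all_goals ring

lemma quatJK_normal (x₀ x₁ b₀ b₁ c₀ c₁ : ℝ) :
    (x₀ • gam 0 + x₁ • gam 1) * hat (quatJK b₀ b₁ c₀ c₁)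
        - quatJK b₀ b₁ c₀ c₁ * (x₀ • gam 0 + x₁ • gam 1) =
      (-2 * (x₀ * b₁ + x₁ * c₀)) • gam 2 + (2 * (x₀ * c₁ + x₁ * b₀)) • gam 3 := by
  ext <;> apply Complex.ext <;> simp [quatJK, lor, iA, gam, hat, hatA, sigmaA,
    QuadraticAlgebra.re_one, QuadraticAlgebra.im_one]
  all_goals ring

lemma smul_gam_add (x₀ x₁ x₂ x₃ : ℝ) :
    (x₀ • gam 0 + x₁ • gam 1) + (x₂ • gam 2 + x₃ • gam 3) = emb ![x₀, x₁, x₂, x₃] := by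
  simp [emb, Fin.sum_univ_four]; abel

/-- The two terms of q η̂ - η q have the same scalar product with a normal vector. Pairing with the
first term alone thus loses a factor 2, which is the 2 in the definition of B. -/
lemma two_realProd_quatJK (x₂ x₃ y₀ y₁ b₀ b₁ c₀ c₁ : ℝ) :
    2 * realProd ((x₂ • gam 2 + x₃ • gam 3) * hat (quatJK b₀ b₁ c₀ c₁))
        (y₀ • gam 0 + y₁ • gam 1) =
      -(2 * (x₂ * b₁ + x₃ * c₁) * y₀) + -2 * (x₂ * c₀ + x₃ * b₀) * y₁ := by
  simp [realProd, formH, quatJK, lor, iA, gam, hat, hatA, sigmaA]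
  ring

/-- The common right factor ζ̂ has norm 1 and the common left factor σi has H(σi, σi) = -1; hence
the sign. -/
lemma realProd_cliffordOdd {z : HAC} (hz : formH z z = 1) (q e n : HAC) :
    realProd (cliffordOdd q (e * z)) (cliffordOdd n z) = -realProd (q * hat e) n := by
  have h₀ : formH (gam 0) (gam 0) = -1 := by
    ext <;> simp [formH, gam, sigmaA, iA, QuadraticAlgebra.re_one, QuadraticAlgebra.im_one]
  have : cliffordOdd q (e * z) = gam 0 * (q * hat e * hat z) := by
    simp [cliffordOdd, hat_mul, mul_assoc]
  rw [realProd, this, cliffordOdd, mul_assoc (gam 0) n, formH_mul_left, formH_mul_right,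
    formH_hat_self hz, h₀, one_mul]
  simp [realProd]

/-- The Dirac equation expresses the covariant derivatives `n₂, n₃` of a normalized spinor `z` by
six real numbers. -/
lemma exists_quatJK_of_dirac {z n₂ n₃ : HAC} (hz : formH z z = 1) (hτ : tau z = z)
    (hτ₂ : tau n₂ = n₂) (hτ₃ : tau n₃ = n₃)
    (h₂ : star n₂ * z + star z * n₂ = 0) (h₃ : star n₃ * z + star z * n₃ = 0) {x₀ x₁ : ℝ}
    (hD : -cliffordOdd (gam 2) n₂ + cliffordOdd (gam 3) n₃ =
      cliffordOdd (x₀ • gam 0 + x₁ • gam 1) z) :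
    ∃ p r a b c d : ℝ, n₂ = quatJK p a b r * z ∧ n₃ = quatJK c r p d * z := by
  have hz₁ := star_mul_self_eq_one hz
  have hz₂ := self_mul_star_eq_one hz
  have hzh := self_mul_star_eq_one (formH_hat_self hz)
  -- Multiplying the derivative of ζ̄ζ = 1 by ζ on the left and ζ̄ on the right shows that η = n ζ̄
  -- is purely imaginary.
  have im : ∀ n : HAC, star n * z + star z * n = 0 → star (n * star z) = -(n * star z) := by
    intro n hn
    have h₁ : z * (star n * z + star z * n) * star z = 0 := by rw [hn]; simp
    have h₂ : z * (star n * z + star z * n) * star z =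
        z * star n * (z * star z) + (z * star z) * (n * star z) := by noncomm_ring
    rw [h₂, hz₂] at h₁
    rw [star_mul, star_star]
    simpa using eq_neg_of_add_eq_zero_left h₁
  have back : ∀ n : HAC, n = n * star z * z := fun n => by rw [mul_assoc, hz₁, mul_one]
  obtain ⟨u, u', b, b', c, c', e₂⟩ := exists_coords_of_tau_star
    (by rw [tau_mul, tau_star, hτ, hτ₂]) (im n₂ h₂)
  obtain ⟨v, v', d, d', f, f', e₃⟩ := exists_coords_of_tau_star
    (by rw [tau_mul, tau_star, hτ, hτ₃]) (im n₃ h₃)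
  -- The Dirac equation with the factors σi and ζ̂ removed, now an equation on η₂ and η₃ alone.
  have hD' : -(gam 2 * hat (n₂ * star z)) + gam 3 * hat (n₃ * star z) =
      x₀ • gam 0 + x₁ • gam 1 := by
    have h₁ : ∀ w : HAC, -(gam 0 * (gam 0 * w)) = w := fun w => by
      rw [← mul_assoc, gam_zero_mul_gam_zero]; simp
    rw [hat_mul, hat_mul, ← star_hat]
    calc _ = -(gam 0 * ((-cliffordOdd (gam 2) n₂ + cliffordOdd (gam 3) n₃) * star (hat z))) := by
            rw [← h₁ (-(gam 2 * (hat n₂ * star (hat z))) + gam 3 * (hat n₃ * star (hat z)))]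
            simp only [cliffordOdd]
            noncomm_ring
      _ = _ := by
            rw [hD, cliffordOdd, mul_assoc, hzh, mul_one, h₁]
  rw [e₂, e₃] at hD'
  -- The J and K coordinates of the equation kill the I components of η₂ and η₃. Among the others,
  -- only the coordinates that vanish on the right-hand side are kept; they give f = b and d' = c'.
  -- The two coordinates along σi and I would express the mean curvature vector.
  have E := fun k : HAC → ℝ => congrArg k hD'
  have E₁ := E (fun w => w.re.re.im)
  have E₃ := E (fun w => w.imI.im.re)
  have E₅ := E (fun w => w.imJ.re.im)
  have E₆ := E (fun w => w.imJ.im.im)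
  have E₇ := E (fun w => w.imK.re.re)
  have E₈ := E (fun w => w.imK.im.re)
  simp [lor, iA, gam, hat, hatA, sigmaA, QuadraticAlgebra.im_one] at E₁ E₃ E₅ E₆ E₇ E₈
  refine ⟨b, c', b', c, d, f', ?_, ?_⟩
  · rw [back n₂, e₂]
    congr 1
    ext1 <;> simp [quatJK, lor, iA]
    ext <;> simp <;> linarith
  · rw [back n₃, e₃]
    have h₁ : d' = c' := by linarith
    have h₂ : f = b := by linarith
    subst h₁ h₂
    congr 1
    ext1 <;> simp [quatJK, lor, iA]
    ext <;> simp <;> linarith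

/-- The element by which the connection forms `κ`, `μ` act on the coordinates of spinors. -/
def connQuat (κ μ : ℝ) : HAC :=
  (κ / 2) • evenProd (gam 0) (gam 1) + (μ / 2) • evenProd (gam 2) (gam 3)

lemma star_connQuat (κ μ : ℝ) : star (connQuat κ μ) = -connQuat κ μ := by
  ext <;> simp [connQuat, evenProd, gam, hat, hatA, sigmaA, iA,
    QuadraticAlgebra.re_one, QuadraticAlgebra.im_one]

lemma tau_connQuat (κ μ : ℝ) : tau (connQuat κ μ) = connQuat κ μ := by
  rw [connQuat, tau_add, tau_smul, tau_smul]
  congr 2 <;> ext <;> simp [evenProd, gam, hat, hatA, sigmaA, iA, tau, conjA,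
    QuadraticAlgebra.re_one, QuadraticAlgebra.im_one]

/-- Infinitesimal form of the covering q ↦ a q â⁻¹. The right-hand side collects the connection
terms of a vector in a moving frame, where ∇e₀ = κ e₁, ∇e₁ = κ e₀, ∇e₂ = μ e₃ and ∇e₃ = μ e₂. -/
lemma connQuat_commutator (κ μ x₀ x₁ x₂ x₃ : ℝ) :
    ((x₀ • gam 0 + x₁ • gam 1) + (x₂ • gam 2 + x₃ • gam 3)) * hat (connQuat κ μ)
      - connQuat κ μ * ((x₀ • gam 0 + x₁ • gam 1) + (x₂ • gam 2 + x₃ • gam 3)) =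
    ((κ * x₁) • gam 0 + (κ * x₀) • gam 1) + ((μ * x₃) • gam 2 + (μ * x₂) • gam 3) := by
  ext <;> apply Complex.ext <;> simp [connQuat, evenProd, iA, gam, hat, hatA, sigmaA,
    QuadraticAlgebra.re_one, QuadraticAlgebra.im_one]
  all_goals ring

/-- The derivative of the spinor coordinate is n + eζ, with n the covariant derivative and e the
connection. The part eζ passes through ξ as the commutator c, and c completes the derivative q' of
the vector coordinate to a covariant derivative, so that only n remains outside ξ. -/
lemma xiQ_leibniz {z n e q q' c : HAC} (he : star e = -e) (hc : q * hat e - e * q = c) :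
    -(star (n + e * z) * q * hat z + star z * q * hat (n + e * z)) + xiQ z q' =
      xiQ z (q' + c) - (star n * q * hat z + star z * q * hat n) := by
  have h := xiQ_variation (z := z) q he
  rw [hc] at h
  rw [xiQ_add, ← h, hat_add, star_add]
  simp only [add_mul, mul_add]
  abel

end Dirac

/-! ### Invariance under the spin groups -/

section Groups

lemma star_boostE_mul (v : ℝ) : star (boostE v) = boostE (-v) := by
  ext <;> simp [boostE, lor, sigmaA, iA]

lemma hat_boostE (v : ℝ) : hat (boostE v) = boostE (-v) := by
  ext <;> simp [boostE, lor, sigmaA, iA, hat, hatA]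

lemma star_boostM (v : ℝ) : star (boostM v) = boostM (-v) := by
  ext <;> simp [boostM, lor, iA]

lemma hat_boostM (v : ℝ) : hat (boostM v) = boostM v := by
  ext <;> simp [boostM, lor, iA, hat, hatA]

lemma boostE_mul_boostM_comm (v w : ℝ) : boostE v * boostM w = boostM w * boostE v := by
  ext1 <;> simp [boostE, boostM] <;> ring

lemma boostE_tangent (v x₂ x₃ : ℝ) : (x₂ • gam 2 + x₃ • gam 3) * boostE (-v) =
    boostE v * (x₂ • gam 2 + x₃ • gam 3) := by
  ext <;> apply Complex.ext <;> simp [boostE, lor, iA, gam, sigmaA] <;> ring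

lemma boostM_normal (v x₀ x₁ : ℝ) : (x₀ • gam 0 + x₁ • gam 1) * boostM v =
    boostM v * (x₀ • gam 0 + x₁ • gam 1) := by
  ext <;> apply Complex.ext <;> simp [boostM, lor, iA, gam, sigmaA] <;> ring

lemma star_mul_self_spinE (a : spinE) : star (a : HAC) * a = 1 := by
  obtain ⟨_, v, rfl | rfl⟩ := a <;> simp [star_boostE_mul, boostE_mul, boostE_zero]

lemma star_mul_self_spinM (a : spinM) : star (a : HAC) * a = 1 := by
  obtain ⟨_, v, rfl | rfl⟩ := a <;> simp [star_boostM, boostM_mul, boostM_zero]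

lemma hat_spinM (a : spinM) : hat (a : HAC) = a := by
  obtain ⟨_, v, rfl | rfl⟩ := a <;> simp [hat_neg, hat_boostM]

lemma hat_spinE (a : spinE) : hat (a : HAC) = star (a : HAC) := by
  obtain ⟨_, v, rfl | rfl⟩ := a <;> simp [hat_neg, hat_boostE, star_boostE_mul]

lemma spinE_mul_star_self (a : spinE) : (a : HAC) * star (a : HAC) = 1 := by
  obtain ⟨_, v, rfl | rfl⟩ := a <;> simp [star_boostE_mul, boostE_mul, boostE_zero]

lemma spinE_spinM_comm (a : spinE) (b : spinM) : (a : HAC) * b = b * a := by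
  obtain ⟨_, v, rfl | rfl⟩ := a <;> obtain ⟨_, w, rfl | rfl⟩ := b <;>
    simp [boostE_mul_boostM_comm]

lemma tangent_spinE (a : spinE) (x₂ x₃ : ℝ) :
    (x₂ • gam 2 + x₃ • gam 3) * star (a : HAC) = (a : HAC) * (x₂ • gam 2 + x₃ • gam 3) := by
  obtain ⟨_, v, rfl | rfl⟩ := a <;> simp only [star_neg, mul_neg, neg_mul, star_boostE_mul,
    boostE_tangent]

lemma normal_spinM (a : spinM) (x₀ x₁ : ℝ) :
    (x₀ • gam 0 + x₁ • gam 1) * (a : HAC) = (a : HAC) * (x₀ • gam 0 + x₁ • gam 1) := by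
  obtain ⟨_, v, rfl | rfl⟩ := a <;> simp only [mul_neg, neg_mul, boostM_normal]

/-- If both components of the vector were transformed by the product ab, invariance would be
immediate. Each is transformed by one factor only, and this suffices because each group acts
trivially on the other plane: a t = t ā with â = ā, and b n = n b with b̂ = b. -/
lemma xiQ_spin (a : spinE) (b : spinM) (z : HAC) (x₀ x₁ x₂ x₃ : ℝ) :
    xiQ (a * b * z) ((a : HAC) * (x₀ • gam 0 + x₁ • gam 1) * star (hat (a : HAC)) +
        (b : HAC) * (x₂ • gam 2 + x₃ • gam 3) * star (hat (b : HAC))) =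
      xiQ z ((x₀ • gam 0 + x₁ • gam 1) + (x₂ • gam 2 + x₃ • gam 3)) := by
  have ha := star_mul_self_spinE a
  have hb := star_mul_self_spinM b
  have hab := spinE_spinM_comm a b
  have ha' := spinE_mul_star_self a
  rw [hat_spinE, hat_spinM, star_star]
  set n := x₀ • gam 0 + x₁ • gam 1 with hn
  set t := x₂ • gam 2 + x₃ • gam 3 with ht
  have hna : n * (b : HAC) = b * n := normal_spinM b x₀ x₁
  have hta : t * star (a : HAC) = a * t := tangent_spinE a x₂ x₃
  have h₁ : star (b : HAC) * (star (a : HAC) * ((a : HAC) * n * a) * star (a : HAC)) * b = n := by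
    calc _ = star (b : HAC) * ((star (a : HAC) * a) * n * (a * star (a : HAC))) * b := by
            noncomm_ring
      _ = _ := by rw [ha, ha', one_mul, mul_one, mul_assoc, hna, ← mul_assoc, hb, one_mul]
  have h₂ : star (a : HAC) * (star (b : HAC) * ((b : HAC) * t * star (b : HAC)) * b) *
      star (a : HAC)
      = t := by
    calc _ = star (a : HAC) * ((star (b : HAC) * b) * t * (star (b : HAC) * b)) * star (a : HAC) := by
            noncomm_ring
      _ = _ := by rw [hb, one_mul, mul_one, mul_assoc, hta, ← mul_assoc, ha, one_mul]
  have hab' : star (b : HAC) * star (a : HAC) = star (a : HAC) * star (b : HAC) := by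
    rw [← star_mul, ← star_mul, hab]
  have hab'' : star (a : HAC) * (b : HAC) = b * star (a : HAC) := by
    rw [← hat_spinE, ← hat_spinM b, ← hat_mul, hab, hat_mul]
  simp only [xiQ, star_mul, hat_mul, hat_spinE, hat_spinM, neg_inj, mul_add, add_mul]
  congr 1
  · calc _ = star z * (star (b : HAC) * (star (a : HAC) * ((a : HAC) * n * a) * star (a : HAC)) * b)
          * hat z := by noncomm_ring
      _ = _ := by rw [h₁]
  · calc _ = star z * (star (b : HAC) * star (a : HAC)) * ((b : HAC) * t * star (b : HAC)) *
          (star (a : HAC) * b) * hat z := by noncomm_ring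
      _ = star z * (star (a : HAC) * (star (b : HAC) * ((b : HAC) * t * star (b : HAC)) * b)
          * star (a : HAC)) * hat z := by rw [hab', hab'']; noncomm_ring
      _ = _ := by rw [h₂]

end Groups

/-! ### Calculus of functions with values in `HAC` -/

section Calculus

instance : FiniteDimensional ℝ HAC := by
  let f : HAC →ₗ[ℝ] (Fin 4 → Fin 2 → ℂ) :=
    { toFun := coords
      map_add' := coords.map_add
      map_smul' := fun r z => by ext i j; fin_cases i <;> fin_cases j <;> simp [coords] }
  exact Module.Finite.of_injective f coords_injective

/-- Multiplication of quaternions as a continuous bilinear map. -/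
def mulL : HAC →L[ℝ] HAC →L[ℝ] HAC :=
  LinearMap.toContinuousLinearMap
    ((LinearMap.toContinuousLinearMap : (HAC →ₗ[ℝ] HAC) ≃ₗ[ℝ] _).toLinearMap ∘ₗ LinearMap.mul ℝ HAC)

lemma mulL_apply (z w : HAC) : mulL z w = z * w := rfl

/-- `hat` as a continuous linear map. -/
def hatL : HAC →L[ℝ] HAC :=
  LinearMap.toContinuousLinearMap { toFun := hat, map_add' := hat_add, map_smul' := hat_smul }

lemma hatL_apply (z : HAC) : hatL z = hat z := rfl

/-- Conjugation as a continuous linear map. -/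
def conjL : HAC →L[ℝ] HAC :=
  LinearMap.toContinuousLinearMap
    { toFun := star, map_add' := star_add, map_smul' := star_real_smul }

lemma conjL_apply (z : HAC) : conjL z = star z := rfl

/-- `tau` as a continuous linear map. -/
def tauL : HAC →L[ℝ] HAC :=
  LinearMap.toContinuousLinearMap { toFun := tau, map_add' := tau_add, map_smul' := tau_smul }

lemma tauL_apply (z : HAC) : tauL z = tau z := rfl

/-- `toR22` as a continuous linear map. -/
def toR22L : HAC →L[ℝ] R22 := LinearMap.toContinuousLinearMap toR22

lemma toR22L_apply (z : HAC) : toR22L z = toR22 z := rfl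

variable {M : Type*} [TopologicalSpace M] [ChartedSpace Plane M]
  {A B C : Type*} [NormedAddCommGroup A] [NormedSpace ℝ A] [NormedAddCommGroup B] [NormedSpace ℝ B]
  [NormedAddCommGroup C] [NormedSpace ℝ C]

/-- The differential of a vector valued function. -/
def vderiv (f : M → A) (x : M) : TangentSpace (𝓡 2) x →L[ℝ] A := mfderiv (𝓡 2) 𝓘(ℝ, A) f x

lemma vderiv_clm (L : A →L[ℝ] B) {f : M → A} {x : M} (hf : MDifferentiableAt (𝓡 2) 𝓘(ℝ, A) f x) :
    MDifferentiableAt (𝓡 2) 𝓘(ℝ, B) (fun y => L (f y)) x ∧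
      ∀ X, vderiv (fun y => L (f y)) x X = L (vderiv f x X) := by
  have h := (L.hasMFDerivAt (x := f x)).comp x hf.hasMFDerivAt
  refine ⟨h.mdifferentiableAt, fun X => ?_⟩
  have := h.mfderiv
  exact congrArg (fun l => l X) this

lemma vderiv_bilin (L : A →L[ℝ] B →L[ℝ] C) {f : M → A} {g : M → B} {x : M}
    (hf : MDifferentiableAt (𝓡 2) 𝓘(ℝ, A) f x) (hg : MDifferentiableAt (𝓡 2) 𝓘(ℝ, B) g x) :
    MDifferentiableAt (𝓡 2) 𝓘(ℝ, C) (fun y => L (f y) (g y)) x ∧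
      ∀ X, vderiv (fun y => L (f y) (g y)) x X = L (vderiv f x X) (g x) +
        L (f x) (vderiv g x X) := by
  have h₁ : HasMFDerivAt (𝓡 2) 𝓘(ℝ, A × B) (fun y => (f y, g y)) x
      ((vderiv f x).prod (vderiv g x)) :=
    ⟨hf.hasMFDerivAt.1.prodMk hg.hasMFDerivAt.1, hf.hasMFDerivAt.2.prodMk hg.hasMFDerivAt.2⟩
  have h₂ := (L.isBoundedBilinearMap.hasFDerivAt (f x, g x)).hasMFDerivAt
  have h := HasMFDerivAt.comp x h₂ h₁
  refine ⟨h.mdifferentiableAt, fun X => ?_⟩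
  exact (congrArg (fun l => l X) h.mfderiv).trans (add_comm _ _)

lemma vderiv_congr {f g : M → A} {x : M} (h : f =ᶠ[𝓝 x] g) : vderiv f x = vderiv g x := by
  exact h.mfderiv_eq

lemma vderiv_const (c : A) (x : M) : vderiv (fun _ : M => c) x = 0 := by
  exact mfderiv_const

lemma vderiv_add {f g : M → A} {x : M} (hf : MDifferentiableAt (𝓡 2) 𝓘(ℝ, A) f x)
    (hg : MDifferentiableAt (𝓡 2) 𝓘(ℝ, A) g x) :
    MDifferentiableAt (𝓡 2) 𝓘(ℝ, A) (fun y => f y + g y) x ∧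
      ∀ X, vderiv (fun y => f y + g y) x X = vderiv f x X + vderiv g x X := by
  have h := hf.hasMFDerivAt.add hg.hasMFDerivAt
  refine ⟨h.mdifferentiableAt, fun X => ?_⟩
  exact congrArg (fun l => l X) h.mfderiv

/-- The derivative of `-ζ̄ q ζ̂`. -/
lemma vderiv_xiQ {f q : M → HAC} {x : M} (hf : MDifferentiableAt (𝓡 2) 𝓘(ℝ, HAC) f x)
    (hq : MDifferentiableAt (𝓡 2) 𝓘(ℝ, HAC) q x) :
    MDifferentiableAt (𝓡 2) 𝓘(ℝ, HAC) (fun y => xiQ (f y) (q y)) x ∧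
      ∀ X, vderiv (fun y => xiQ (f y) (q y)) x X =
        -(star (vderiv f x X) * q x * hat (f x) + star (f x) * q x * hat (vderiv f x X))
          + xiQ (f x) (vderiv q x X) := by
  obtain ⟨d₁, e₁⟩ := vderiv_clm conjL hf
  obtain ⟨d₂, e₂⟩ := vderiv_clm hatL hf
  obtain ⟨d₃, e₃⟩ := vderiv_bilin mulL d₁ hq
  obtain ⟨d₄, e₄⟩ := vderiv_bilin mulL d₃ d₂
  obtain ⟨d₅, e₅⟩ := vderiv_clm (-ContinuousLinearMap.id ℝ HAC) d₄
  simp only [neg_apply, ContinuousLinearMap.id_apply, mulL_apply, hatL_apply,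
    conjL_apply] at d₅ e₁ e₂ e₃ e₄ e₅
  refine ⟨d₅, fun X => ?_⟩
  simp only [xiQ]
  rw [e₅, e₄, e₃, e₂, e₁]
  simp only [add_mul]
  abel

lemma contMDiffOn_clm (L : A →L[ℝ] B) {f : M → A} {U : Set M}
    (hf : ContMDiffOn (𝓡 2) 𝓘(ℝ, A) ∞ f U) : ContMDiffOn (𝓡 2) 𝓘(ℝ, B) ∞ (fun y => L (f y)) U :=
  L.contMDiff.comp_contMDiffOn hf

lemma contMDiffOn_bilin (L : A →L[ℝ] B →L[ℝ] C) {f : M → A} {g : M → B} {U : Set M}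
    (hf : ContMDiffOn (𝓡 2) 𝓘(ℝ, A) ∞ f U) (hg : ContMDiffOn (𝓡 2) 𝓘(ℝ, B) ∞ g U) :
    ContMDiffOn (𝓡 2) 𝓘(ℝ, C) ∞ (fun y => L (f y) (g y)) U :=
  (contMDiffOn_clm L hf).clm_apply hg

lemma contMDiffOn_xiQ {f q : M → HAC} {U : Set M} (hf : ContMDiffOn (𝓡 2) 𝓘(ℝ, HAC) ∞ f U)
    (hq : ContMDiffOn (𝓡 2) 𝓘(ℝ, HAC) ∞ q U) :
    ContMDiffOn (𝓡 2) 𝓘(ℝ, HAC) ∞ (fun y => xiQ (f y) (q y)) U :=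
  contMDiffOn_clm (-ContinuousLinearMap.id ℝ HAC)
    (contMDiffOn_bilin mulL (contMDiffOn_bilin mulL (contMDiffOn_clm conjL hf) hq)
      (contMDiffOn_clm hatL hf))

/-- A differentiable function is smooth if its derivatives along smooth local vector fields are
smooth. -/
lemma contMDiff_of_vderiv [IsManifold (𝓡 2) ∞ M] {F : M → A}
    (hF : MDifferentiable (𝓡 2) 𝓘(ℝ, A) F)
    (h : ∀ x₀ : M, ∃ U : Set M, IsOpen U ∧ x₀ ∈ U ∧ ∀ W ⊆ U, ∀ Y : (x : M) → TangentSpace (𝓡 2) x,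
      IsOpen W → ContMDiffOn (𝓡 2) ((𝓡 2).prod 𝓘(ℝ, Plane)) ∞
        (fun x ↦ TotalSpace.mk' Plane x (Y x)) W →
      ContMDiffOn (𝓡 2) 𝓘(ℝ, A) ∞ (fun y => vderiv F y (Y y)) W) :
    ContMDiff (𝓡 2) 𝓘(ℝ, A) ∞ F := by
  intro x₀
  obtain ⟨U, hU, hx₀, hY⟩ := h x₀
  set e := trivializationAt Plane (TangentSpace (𝓡 2) : M → Type _) x₀ with he
  set ψ := extChartAt (𝓡 2) x₀ with hψ
  have hbase : e.baseSet = (chartAt Plane x₀).source := TangentBundle.trivializationAt_baseSet x₀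
  have hsrc : ψ.source = (chartAt Plane x₀).source := extChartAt_source _ _
  set W := U ∩ (chartAt Plane x₀).source with hW
  have hWo : IsOpen W := hU.inter (chartAt Plane x₀).open_source
  set O := ψ.target ∩ ψ.symm ⁻¹' U with hO
  have hOo : IsOpen O := (continuousOn_extChartAt_symm x₀).isOpen_inter_preimage
    (isOpen_extChartAt_target x₀) hU
  have hOW : ∀ z ∈ O, ψ.symm z ∈ W := fun z hz => ⟨hz.2, hsrc ▸ ψ.map_target hz.1⟩
  have hsymm : ContMDiffOn 𝓘(ℝ, Plane) (𝓡 2) ∞ ψ.symm O :=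
    (contMDiffOn_extChartAt_symm x₀).mono Set.inter_subset_left
  -- In the chart at x₀ the derivative of F is its intrinsic differential composed with the tangent
  -- bundle trivialization.
  have hderiv : ∀ z ∈ O, HasFDerivAt (F ∘ ψ.symm)
      ((vderiv F (ψ.symm z)).comp (e.symmL ℝ (ψ.symm z))) z := by
    intro z hz
    have h₁ : MDifferentiableAt 𝓘(ℝ, Plane) (𝓡 2) ψ.symm z :=
      ((hsymm z hz).contMDiffAt (hOo.mem_nhds hz)).mdifferentiableAt (by simp)
    have h₂ := HasMFDerivAt.comp z (hF (ψ.symm z)).hasMFDerivAt h₁.hasMFDerivAt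
    have h₃ := TangentBundle.symmL_trivializationAt (I := 𝓡 2) (x₀ := x₀) (hOW z hz).2
    rw [hψ.symm, ψ.right_inv hz.1] at h₃
    simp only [modelWithCornersSelf_coe, Set.range_id, mfderivWithin_univ] at h₃
    have h₄ := h₂.hasFDerivAt
    rw [← h₃] at h₄
    exact h₄
  have hsm : ContDiffOn ℝ ∞ (F ∘ ψ.symm) O := by
    rw [contDiffOn_infty_iff_fderiv_of_isOpen hOo]
    refine ⟨fun z hz => (hderiv z hz).differentiableAt.differentiableWithinAt, ?_⟩
    -- In finite dimension a family of linear maps is smooth as soon as its values on each fixed v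
    -- are. A constant v in the chart is a smooth local vector field on M, to which the hypothesis
    -- applies.
    rw [contDiffOn_clm_apply]
    intro v
    have h₁ : ContMDiffOn (𝓡 2) ((𝓡 2).prod 𝓘(ℝ, Plane)) ∞
        (fun x ↦ TotalSpace.mk' Plane x (e.symmL ℝ x v)) e.baseSet := by
      rw [e.contMDiffOn_section_baseSet_iff]
      apply (contMDiffOn_const (c := v)).congr
      intro y hy
      rw [e.symmL_apply hy, e.apply_mk_symm hy]
    have h₂ := hY W Set.inter_subset_left _ hWo
      (h₁.mono (by rw [hbase]; exact Set.inter_subset_right))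
    have h₃ := (h₂.comp hsymm hOW).contDiffOn
    refine h₃.congr fun z hz => ?_
    rw [(hderiv z hz).fderiv]
    rfl
  have hx₀s : x₀ ∈ (chartAt Plane x₀).source := mem_chart_source _ x₀
  have hcomp : ContMDiffOn (𝓡 2) 𝓘(ℝ, A) ∞ ((F ∘ ψ.symm) ∘ ψ) W := by
    refine hsm.contMDiffOn.comp (contMDiffOn_extChartAt.mono Set.inter_subset_right) ?_
    intro y hy
    have hy' : y ∈ ψ.source := hsrc ▸ hy.2
    refine ⟨ψ.map_source hy', ?_⟩
    rw [Set.mem_preimage, ψ.left_inv hy']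
    exact hy.1
  have : ContMDiffOn (𝓡 2) 𝓘(ℝ, A) ∞ F W := hcomp.congr fun y hy => by
    simp only [Function.comp_apply]
    rw [ψ.left_inv (hsrc ▸ hy.2)]
  exact (this x₀ ⟨hx₀, hx₀s⟩).contMDiffAt (hWo.mem_nhds ⟨hx₀, hx₀s⟩)

end Calculus

/-! ### Lorentzian bundles of rank two: frames, spinorial frames, connections -/

section PrincipalBundles

variable {M : Type*} [TopologicalSpace M] {G : Submonoid HAC}
  {P : M → Type*} [TopologicalSpace (TotalSpace G P)] [∀ x, TopologicalSpace (P x)]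
  [FiberBundle G P]

lemma exists_eq_trivialization {x₀ x : M} (hx : x ∈ (trivializationAt G P x₀).baseSet) (a : G) :
    ∃ p : P x, trivializationAt G P x₀ (TotalSpace.mk' G x p) = (x, a) := by
  set e := trivializationAt G P x₀
  have h := e.proj_symm_apply' (b := x) (x := a) hx
  have h' := e.apply_symm_apply' (b := x) (x := a) hx
  -- The point of the total space is made a variable so that the equality of base points can be
  -- substituted.
  generalize e.toOpenPartialHomeomorph.symm (x, a) = z at h h'
  obtain ⟨y, p⟩ := z
  obtain rfl : y = x := h
  exact ⟨p, h'⟩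

lemma trivializationAt_injective {x₀ x : M} (hx : x ∈ (trivializationAt G P x₀).baseSet) {p q : P x}
    (h : (trivializationAt G P x₀ (TotalSpace.mk' G x p)).2 =
      (trivializationAt G P x₀ (TotalSpace.mk' G x q)).2) : p = q := by
  set e := trivializationAt G P x₀
  have h₁ : ∀ r : P x, TotalSpace.mk' G x r ∈ e.source := fun r => e.mem_source.2 hx
  have h₂ : e (TotalSpace.mk' G x p) = e (TotalSpace.mk' G x q) := by
    ext1
    · rw [e.coe_fst (h₁ p), e.coe_fst (h₁ q)]
    · exact h
  have := e.injOn (h₁ p) (h₁ q) h₂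
  exact TotalSpace.mk_injective x this

lemma nonempty_principal_fibre (G : Submonoid HAC) {P : M → Type*}
    [TopologicalSpace (TotalSpace G P)] [∀ x, TopologicalSpace (P x)] [FiberBundle G P] (x : M) :
    Nonempty (P x) :=
  let ⟨p, _⟩ := exists_eq_trivialization (P := P) (mem_baseSet_trivializationAt G P x) (1 : G)
  ⟨p⟩

end PrincipalBundles

section LorentzBundles

variable {M : Type*} [TopologicalSpace M] [ChartedSpace Plane M]
  {V : M → Type*} [TopologicalSpace (TotalSpace Plane V)]
  [∀ x, AddCommGroup (V x)] [∀ x, Module ℝ (V x)] [∀ x, TopologicalSpace (V x)]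
  [FiberBundle Plane V] [VectorBundle ℝ Plane V]
  {k : LorentzMetric V}

section Fibre

variable {x : M} {o : Orientation ℝ (V x) (Fin 2)} {fut : Set (V x)} {f : Fin 2 → V x}

lemma LorentzMetric.val_combination (h₀ : k.val x (f 0) (f 0) = -1) (h₁ : k.val x (f 1) (f 1) = 1)
    (h₂ : k.val x (f 0) (f 1) = 0) (a b c d : ℝ) :
    k.val x (a • f 0 + b • f 1) (c • f 0 + d • f 1) = -(a * c) + b * d := by
  have h₃ : k.val x (f 1) (f 0) = 0 := by rw [k.symm, h₂]
  simp only [map_add, map_smul, add_apply, smul_apply, h₀, h₁, h₂, h₃, smul_eq_mul]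
  ring

lemma IsPositiveFrame.eq_combination (hf : IsPositiveFrame k o fut f) (v : V x) :
    v = (-(k.val x v (f 0))) • f 0 + k.val x v (f 1) • f 1 := by
  obtain ⟨h₀, h₁, h₂, -, b, hb, -⟩ := hf
  have hv := b.sum_repr v
  rw [Fin.sum_univ_two, hb] at hv
  have e₀ := k.val_combination h₀ h₁ h₂ (b.repr v 0) (b.repr v 1) 1 0
  have e₁ := k.val_combination h₀ h₁ h₂ (b.repr v 0) (b.repr v 1) 0 1
  rw [hv] at e₀ e₁
  simp only [one_smul, zero_smul, add_zero, zero_add, mul_one, mul_zero, neg_zero] at e₀ e₁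
  rw [e₀, e₁, neg_neg, hv]

lemma IsPositiveFrame.ext (hf : IsPositiveFrame k o fut f) {v w : V x}
    (h₀ : k.val x v (f 0) = k.val x w (f 0)) (h₁ : k.val x v (f 1) = k.val x w (f 1)) : v = w := by
  rw [hf.eq_combination v, hf.eq_combination w, h₀, h₁]

lemma IsPositiveFrame.val_eq (hf : IsPositiveFrame k o fut f) (v w : V x) :
    k.val x v w = -(k.val x v (f 0) * k.val x w (f 0)) + k.val x v (f 1) * k.val x w (f 1) := by
  conv_lhs => rw [hf.eq_combination v, hf.eq_combination w]
  rw [k.val_combination hf.1 hf.2.1 hf.2.2.1]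
  ring

/-- Two positively oriented orthonormal frames differ by a boost. -/
lemma IsPositiveFrame.boost {f' : Fin 2 → V x} {t : V x}
    (hfut : fut = connectedComponentIn {v : V x | k.val x v v < 0} t)
    (hf : IsPositiveFrame k o fut f) (hf' : IsPositiveFrame k o fut f') :
    let D := k.val x (f' 0) (f 1)
    f' 0 = √(1 + D ^ 2) • f 0 + D • f 1 ∧ f' 1 = D • f 0 + √(1 + D ^ 2) • f 1 := by
  intro D
  set C := -(k.val x (f' 0) (f 0)) with hC
  set C₁ := -(k.val x (f' 1) (f 0)) with hC₁
  set D₁ := k.val x (f' 1) (f 1) with hD₁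
  have e₀ : f' 0 = C • f 0 + D • f 1 := hf.eq_combination _
  have e₁ : f' 1 = C₁ • f 0 + D₁ • f 1 := hf.eq_combination _
  have n₀ : C ^ 2 = 1 + D ^ 2 := by
    have h := hf'.1
    rw [e₀, k.val_combination hf.1 hf.2.1 hf.2.2.1] at h
    linarith
  have n₁ : D₁ ^ 2 = 1 + C₁ ^ 2 := by
    have h := hf'.2.1
    rw [e₁, k.val_combination hf.1 hf.2.1 hf.2.2.1] at h
    linarith
  have n₂ : C * C₁ = D * D₁ := by
    have h := hf'.2.2.1
    rw [e₀, e₁, k.val_combination hf.1 hf.2.1 hf.2.2.1] at h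
    linarith
  -- Otherwise, by connectedness of the future cone, some timelike future vector is orthogonal to f
  -- 0; but the orthogonal of f 0 is spacelike.
  have hCpos : 0 < C := by
    by_contra hneg
    have hcont : ContinuousOn (fun v : V x => k.val x (f 0) v) fut :=
      (k.val x (f 0)).continuous.continuousOn
    have hpre : IsPreconnected fut := hfut ▸ isPreconnected_connectedComponentIn
    have h₁ : k.val x (f 0) (f 0) ≤ 0 := by rw [hf.1]; norm_num
    have h₂ : 0 ≤ k.val x (f 0) (f' 0) := by rw [k.symm]; linarith
    obtain ⟨v, hv, hv₀⟩ := hpre.intermediate_value hf.2.2.2.1 hf'.2.2.2.1 hcont ⟨h₁, h₂⟩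
    have hv₁ : k.val x v v < 0 := by
      rw [hfut] at hv
      exact connectedComponentIn_subset {v : V x | k.val x v v < 0} t hv
    rw [hf.val_eq v v] at hv₁
    simp only at hv₀
    rw [k.symm x v (f 0), hv₀] at hv₁
    nlinarith [mul_self_nonneg (k.val x v (f 1))]
  obtain ⟨b, hb, hbo⟩ := hf.2.2.2.2
  obtain ⟨b', hb', hbo'⟩ := hf'.2.2.2.2
  have hdet : 0 < C * D₁ - D * C₁ := by
    have h := (b.orientation_eq_iff_det_pos b').1 (hbo.trans hbo'.symm)
    rw [Module.Basis.det_apply, Matrix.det_fin_two] at h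
    simp only [Module.Basis.toMatrix_apply, hb'] at h
    rw [e₀, e₁, ← hb] at h
    simp at h
    linarith
  -- Orthogonality forces the second row of the transition matrix to be l times (D, C). The norms
  -- give l² = 1, and equality of the orientations gives l > 0.
  set l := C * D₁ - D * C₁ with hl
  have hl₁ : C₁ = l * D := by
    have : l * D = D * (C * D₁) - D ^ 2 * C₁ := by rw [hl]; ring
    have h₂ : D * (C * D₁) = C ^ 2 * C₁ := by linear_combination (-C) * n₂
    rw [this, h₂, n₀]; ring
  have hl₂ : D₁ = l * C := by
    have : l * C = C ^ 2 * D₁ - D * (C * C₁) := by rw [hl]; ring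
    rw [this, n₂, n₀]; ring
  have hl₃ : l = 1 := by
    rw [hl₁, hl₂] at n₁
    have : l ^ 2 = 1 := by linear_combination n₁ - l ^ 2 * n₀
    nlinarith
  have hsq : √(1 + D ^ 2) = C := by rw [← n₀, Real.sqrt_sq hCpos.le]
  rw [hsq]
  refine ⟨e₀, ?_⟩
  rw [e₁, hl₁, hl₂, hl₃, one_mul, one_mul]

end Fibre

/-! ### Regularity of scalar products, and connections in moving frames. -/

lemma LorentzMetric.contMDiffOn_val {v w : (x : M) → V x} {U : Set M}
    (hv : ContMDiffOn (𝓡 2) ((𝓡 2).prod 𝓘(ℝ, Plane)) ∞ (fun x ↦ TotalSpace.mk' Plane x (v x)) U)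
    (hw : ContMDiffOn (𝓡 2) ((𝓡 2).prod 𝓘(ℝ, Plane)) ∞ (fun x ↦ TotalSpace.mk' Plane x (w x)) U) :
    ContMDiffOn (𝓡 2) 𝓘(ℝ, ℝ) ∞ (fun x => k.val x (v x) (w x)) U := by
  intro x hx
  have : ContMDiffWithinAt (𝓡 2) ((𝓡 2).prod 𝓘(ℝ, ℝ)) ∞
      (fun m ↦ TotalSpace.mk' ℝ (E := Bundle.Trivial M ℝ) m (k.val m (v m) (w m))) U x :=
    ContMDiffWithinAt.clm_bundle_apply₂ (F₁ := Plane) (F₂ := Plane)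
      k.contMDiff.contMDiffAt.contMDiffWithinAt (hv x hx) (hw x hx)
  simp only [contMDiffWithinAt_totalSpace] at this
  exact this.2

lemma LorentzMetric.mdifferentiableAt_val {v w : (x : M) → V x} {x : M}
    (hv : MDifferentiableAt (𝓡 2) ((𝓡 2).prod 𝓘(ℝ, Plane)) (fun x ↦ TotalSpace.mk' Plane x (v x)) x)
    (hw : MDifferentiableAt (𝓡 2) ((𝓡 2).prod 𝓘(ℝ, Plane)) (fun x ↦ TotalSpace.mk' Plane x (w x)) x) :
    MDifferentiableAt (𝓡 2) 𝓘(ℝ, ℝ) (fun x => k.val x (v x) (w x)) x := by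
  have : MDifferentiableAt (𝓡 2) ((𝓡 2).prod 𝓘(ℝ, ℝ))
      (fun m ↦ TotalSpace.mk' ℝ (E := Bundle.Trivial M ℝ) m (k.val m (v m) (w m))) x :=
    MDifferentiableAt.clm_bundle_apply₂ (F₁ := Plane) (F₂ := Plane)
      (k.contMDiff.contMDiffAt.mdifferentiableAt (by simp)) hv hw
  simp only [mdifferentiableAt_totalSpace] at this
  exact this.2

lemma LorentzMetric.continuousOn_val {v w : (x : M) → V x} {U : Set M}
    (hv : ContinuousOn (fun x ↦ TotalSpace.mk' Plane x (v x)) U)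
    (hw : ContinuousOn (fun x ↦ TotalSpace.mk' Plane x (w x)) U) :
    ContinuousOn (fun x => k.val x (v x) (w x)) U := by
  intro x hx
  have : ContinuousWithinAt
      (fun m ↦ TotalSpace.mk' ℝ (E := Bundle.Trivial M ℝ) m (k.val m (v m) (w m))) U x :=
    ContinuousWithinAt.clm_bundle_apply₂ (F₁ := Plane) (F₂ := Plane)
      k.contMDiff.continuous.continuousAt.continuousWithinAt (hv x hx) (hw x hx)
  rw [FiberBundle.continuousWithinAt_totalSpace] at this
  exact this.2

/-- Coordinates of the covariant derivative of a section in a moving orthonormal frame. -/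
lemma IsMetricConnection.frame_coords [∀ x, IsTopologicalAddGroup (V x)]
    [∀ x, ContinuousSMul ℝ (V x)] {cov : CovariantDerivative (𝓡 2) Plane V}
    (hcov : IsMetricConnection k cov) {o : (x : M) → Orientation ℝ (V x) (Fin 2)}
    {fut : (x : M) → Set (V x)} {f : Fin 2 → (x : M) → V x} {x : M}
    (hf : ∀ᶠ y in 𝓝 x, IsPositiveFrame k (o y) (fut y) (fun i => f i y))
    (hfd : ∀ i, MDifferentiableAt (𝓡 2) ((𝓡 2).prod 𝓘(ℝ, Plane))
      (fun y ↦ TotalSpace.mk' Plane y (f i y)) x)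
    {v : (x : M) → V x} (hv : MDifferentiableAt (𝓡 2) ((𝓡 2).prod 𝓘(ℝ, Plane))
      (fun y ↦ TotalSpace.mk' Plane y (v y)) x) (X : TangentSpace (𝓡 2) x) :
    k.val x (cov v x X) (f 0 x) = vderiv (fun y => k.val y (v y) (f 0 y)) x X
        - k.val x (cov (f 0) x X) (f 1 x) * k.val x (v x) (f 1 x) ∧
    k.val x (cov v x X) (f 1 x) = vderiv (fun y => k.val y (v y) (f 1 y)) x X
        - k.val x (cov (f 0) x X) (f 1 x) * k.val x (v x) (f 0 x) := by
  have hx := hf.self_of_nhds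
  -- The scalar products of the frame vectors are constant, so their derivatives vanish: the matrix
  -- of the connection is reduced to the single form ⟨∇f₀, f₁⟩.
  have c : ∀ (i j : Fin 2) (r : ℝ), (∀ᶠ y in 𝓝 x, k.val y (f i y) (f j y) = r) →
      k.val x (cov (f i) x X) (f j x) + k.val x (f i x) (cov (f j) x X) = 0 := by
    intro i j r h
    have h₁ := hcov (f i) (f j) x (hfd i) (hfd j) X
    have h₂ := vderiv_congr (f := fun y => k.val y (f i y) (f j y)) (g := fun _ => r) h
    rw [vderiv_const] at h₂
    rw [← h₁]
    exact congrArg (fun l => l X) h₂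
  have c₀₀ := c 0 0 (-1) (hf.mono fun y hy => hy.1)
  have c₀₁ := c 0 1 0 (hf.mono fun y hy => hy.2.2.1)
  have c₁₁ := c 1 1 1 (hf.mono fun y hy => hy.2.1)
  rw [k.symm x (f 0 x) (cov (f 0) x X)] at c₀₀
  rw [k.symm x (f 0 x) (cov (f 1) x X)] at c₀₁
  rw [k.symm x (f 1 x) (cov (f 1) x X)] at c₁₁
  have d : ∀ i, vderiv (fun y => k.val y (v y) (f i y)) x X =
      k.val x (cov v x X) (f i x) + k.val x (v x) (cov (f i) x X) := fun i =>
    hcov v (f i) x hv (hfd i) X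
  have v₀ := hx.val_eq (v x) (cov (f 0) x X)
  have v₁ := hx.val_eq (v x) (cov (f 1) x X)
  have z₀ : k.val x (cov (f 0) x X) (f 0 x) = 0 := by linarith
  have z₁ : k.val x (cov (f 1) x X) (f 1 x) = 0 := by linarith
  have z₂ : k.val x (cov (f 1) x X) (f 0 x) = -k.val x (cov (f 0) x X) (f 1 x) := by linarith
  rw [z₀] at v₀
  rw [z₁, z₂] at v₁
  constructor
  · rw [d 0, v₀]; ring
  · rw [d 1, v₁]; ring

/-! #### Spinorial frames -/

variable {G : Submonoid HAC} {c₀ c₁ : HAC} {o : SpaceTimeOrientation k}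
  {P : M → Type*} [TopologicalSpace (TotalSpace G P)] [∀ x, TopologicalSpace (P x)]
  [FiberBundle G P]

/-- The structure group acts transitively on spinorial frames at a point. -/
lemma SpinStructure.exists_act_eq (S : SpinStructure G c₀ c₁ o P)
    (hG : ∀ a : G, ∃ b : G, a * b = 1) {x : M} (p q : P x) : ∃ a : G, S.act p a = q := by
  set e := trivializationAt G P x
  obtain ⟨b, hb⟩ := hG (e (TotalSpace.mk' G x p)).2
  refine ⟨b * (e (TotalSpace.mk' G x q)).2, ?_⟩
  have hx := mem_baseSet_trivializationAt G P x
  apply trivializationAt_injective hx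
  rw [S.trivialization_act _ (trivialization_mem_atlas G P x) x hx, ← mul_assoc, hb, one_mul]

/-- The group contains a one-parameter group of boosts of the standard Lorentzian plane. -/
def HasBoosts (G : Submonoid HAC) (c₀ c₁ : HAC) : Prop :=
  (∀ a b a' b' : ℝ, a • c₀ + b • c₁ = a' • c₀ + b' • c₁ → a = a' ∧ b = b') ∧
  ∃ β : ℝ → HAC, Continuous β ∧ (∀ θ, β θ ∈ G) ∧ ∀ θ a b : ℝ,
    β θ * (a • c₀ + b • c₁) * star (hat (β θ)) =
      (Real.cosh (2 * θ) * a - Real.sinh (2 * θ) * b) • c₀ +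
        (Real.cosh (2 * θ) * b - Real.sinh (2 * θ) * a) • c₁

/-- Near each point there is a smooth spinorial frame. -/
lemma SpinStructure.exists_isLocalSpinFrame (S : SpinStructure G c₀ c₁ o P)
    (hG : HasBoosts G c₀ c₁) (x₀ : M) :
    ∃ (U : Set M) (s : (x : M) → P x), x₀ ∈ U ∧ IsLocalSpinFrame S U s := by
  obtain ⟨hli, β₀, hβ₀, hmem, hβ⟩ := hG
  let β : ℝ → G := fun θ => ⟨β₀ θ, hmem θ⟩
  have hβc : Continuous β := hβ₀.subtype_mk _
  obtain ⟨W, hW, hx₀, f, hf, hfp⟩ := o.locally_frame x₀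
  set e := trivializationAt G P x₀ with he
  set U := W ∩ e.baseSet with hU
  have hUo : IsOpen U := hW.inter e.open_baseSet
  have hex : ∀ x, ∃ p : P x, x ∈ e.baseSet → e (TotalSpace.mk' G x p) = (x, 1) := by
    intro x
    by_cases hx : x ∈ e.baseSet
    · obtain ⟨p, hp⟩ := exists_eq_trivialization (P := P) hx (1 : G)
      exact ⟨p, fun _ => hp⟩
    · exact ⟨(nonempty_principal_fibre G x).some, fun h => absurd h hx⟩
  choose s hs using hex
  -- A section of the principal bundle is continuous once its expression in the trivialization is.
  have cont : ∀ (a : M → G) (s' : (x : M) → P x), ContinuousOn a U →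
      (∀ x ∈ U, e (TotalSpace.mk' G x (s' x)) = (x, a x)) →
      ContinuousOn (fun x ↦ TotalSpace.mk' G x (s' x)) U := by
    intro a s' ha h
    have h₁ : ContinuousOn (fun x => e.toOpenPartialHomeomorph.symm (x, a x)) U := by
      refine e.toOpenPartialHomeomorph.continuousOn_symm.comp (continuousOn_id.prodMk ha) ?_
      intro x hx
      exact e.mem_target.2 hx.2
    refine h₁.congr fun x hx => ?_
    have h₂ : TotalSpace.mk' G x (s' x) ∈ e.source := e.mem_source.2 hx.2
    have h₃ := e.symm_apply_apply h₂
    rw [h x hx] at h₃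
    exact h₃.symm
  have hsc : ContinuousOn (fun x ↦ TotalSpace.mk' G x (s x)) U :=
    cont (fun _ => 1) s continuousOn_const fun x hx => hs x hx.2
  have hfr : ContinuousOn (fun x ↦ TotalSpace.mk' Plane x (S.frame (s x) 1)) U :=
    (S.frame_continuous 1).comp_continuousOn hsc
  -- The frame below the local section s is only known to be continuous. The smooth frame f differs
  -- from it by the boost of rapidity arsinh D, and s is to be corrected by a lift of this boost.
  set D : M → ℝ := fun x => k.val x (f 0 x) (S.frame (s x) 1) with hD
  have hDc : ContinuousOn D U :=
    LorentzMetric.continuousOn_val ((hf 0).continuousOn.mono Set.inter_subset_left) hfr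
  -- The half comes from the double cover, which doubles the rapidity. The sign is there because
  -- `frame_act` expresses old coordinates in terms of new ones.
  set θ : M → ℝ := fun x => -(Real.arsinh (D x)) / 2 with hθ
  have hθc : ContinuousOn θ U :=
    (Real.continuous_arsinh.comp_continuousOn hDc).neg.div_const 2
  have hframe : ∀ x ∈ U, ∀ i, S.frame (S.act (s x) (β (θ x))) i = f i x := by
    intro x hx
    obtain ⟨t, -, ht⟩ := o.future_eq x
    have hp := S.frame_positive (s x)
    have hp' := S.frame_positive (S.act (s x) (β (θ x)))
    obtain ⟨b₀, b₁⟩ := hp.boost ht (hfp x hx.1)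
    have hch : Real.cosh (2 * θ x) = √(1 + D x ^ 2) := by
      rw [hθ, mul_div_cancel₀ _ (two_ne_zero), Real.cosh_neg, Real.cosh_arsinh]
    have hsh : Real.sinh (2 * θ x) = -D x := by
      rw [hθ, mul_div_cancel₀ _ (two_ne_zero), Real.sinh_neg, Real.sinh_arsinh]
    have key : ∀ v : V x,
        -(k.val x v (S.frame (s x) 0)) =
          √(1 + D x ^ 2) * -(k.val x v (S.frame (S.act (s x) (β (θ x))) 0)) +
            D x * k.val x v (S.frame (S.act (s x) (β (θ x))) 1) ∧
        k.val x v (S.frame (s x) 1) =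
          √(1 + D x ^ 2) * (k.val x v (S.frame (S.act (s x) (β (θ x))) 1)) +
            D x * -(k.val x v (S.frame (S.act (s x) (β (θ x))) 0)) := by
      intro v
      have h := S.frame_act (s x) (β (θ x)) v
      simp only [vecCoord] at h
      rw [show ((β (θ x) : G) : HAC) = β₀ (θ x) from rfl, hβ, hch, hsh] at h
      obtain ⟨h₁, h₂⟩ := hli _ _ _ _ h
      exact ⟨by rw [h₁]; ring, by rw [h₂]; ring⟩
    -- Evaluated on the new frame vectors themselves, the change of coordinates gives their
    -- components in the old frame, and these are the components of f.
    have v₀ := key (S.frame (S.act (s x) (β (θ x))) 0)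
    have v₁ := key (S.frame (S.act (s x) (β (θ x))) 1)
    rw [hp'.1, hp'.2.2.1] at v₀
    rw [k.symm x _ (S.frame (S.act (s x) (β (θ x))) 0), hp'.2.2.1, hp'.2.1] at v₁
    have w₀ := hp.eq_combination (S.frame (S.act (s x) (β (θ x))) 0)
    have w₁ := hp.eq_combination (S.frame (S.act (s x) (β (θ x))) 1)
    rw [v₀.1, v₀.2] at w₀
    rw [v₁.1, v₁.2] at w₁
    intro i
    fin_cases i
    · simp only [Fin.zero_eta]
      rw [w₀, b₀]; simp [hD]
    · simp only [Fin.mk_one]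
      rw [w₁, b₁]; simp [hD]
  refine ⟨U, fun x => S.act (s x) (β (θ x)), ⟨hx₀, mem_baseSet_trivializationAt G P x₀⟩, hUo, ?_, ?_⟩
  · apply cont (fun x => β (θ x)) _ (hβc.comp_continuousOn hθc)
    intro x hx
    have h₂ : TotalSpace.mk' G x (S.act (s x) (β (θ x))) ∈ e.source := e.mem_source.2 hx.2
    ext1
    · exact e.coe_fst h₂
    · rw [S.trivialization_act e (trivialization_mem_atlas G P x₀) x hx.2, hs x hx.2, one_mul]
  · intro i
    refine ((hf i).mono Set.inter_subset_left).congr fun x hx => ?_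
    rw [hframe x hx i]

/-! ### The boosts and inverses of the two spin groups. -/

lemma boostE_conj (θ a b : ℝ) :
    boostE θ * (a • gam 0 + b • gam 1) * star (hat (boostE θ)) =
      (Real.cosh (2 * θ) * a - Real.sinh (2 * θ) * b) • gam 0 +
        (Real.cosh (2 * θ) * b - Real.sinh (2 * θ) * a) • gam 1 := by
  rw [hat_boostE, star_boostE_mul, neg_neg, Real.cosh_two_mul, Real.sinh_two_mul, boostE]
  generalize Real.cosh θ = C, Real.sinh θ = S
  simp only [pow_two]
  ext <;> apply Complex.ext <;> simp [lor, iA, gam, sigmaA,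
    QuadraticAlgebra.re_one, QuadraticAlgebra.im_one] <;> ring

lemma hasBoosts_spinE : HasBoosts spinE (gam 0) (gam 1) := by
  refine ⟨fun a b a' b' h => ?_, boostE, ?_, fun v => ⟨v, Or.inl rfl⟩, boostE_conj⟩
  · have e₀ := congrArg (fun z : HAC => z.re.im.im) h
    have e₁ := congrArg (fun z : HAC => z.imI.re.re) h
    simpa [gam, sigmaA, iA, QuadraticAlgebra.re_one] using And.intro e₀ e₁
  · have : boostE = fun v => Real.cosh v • (1 : HAC) + Real.sinh v • evenProd (gam 0) (gam 1) := by
      funext v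
      ext <;> simp [boostE, lor, sigmaA, iA, evenProd, gam, hat, hatA,
        QuadraticAlgebra.re_one, QuadraticAlgebra.im_one, mul_comm]
    rw [this]
    exact (Real.continuous_cosh.smul continuous_const).add
      (Real.continuous_sinh.smul continuous_const)

lemma boostM_conj (θ a b : ℝ) :
    boostM θ * (a • gam 2 + b • gam 3) * star (hat (boostM θ)) =
      (Real.cosh (2 * θ) * a - Real.sinh (2 * θ) * b) • gam 2 +
        (Real.cosh (2 * θ) * b - Real.sinh (2 * θ) * a) • gam 3 := by
  rw [hat_boostM, star_boostM, Real.cosh_two_mul, Real.sinh_two_mul, boostM, boostM,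
    Real.cosh_neg, Real.sinh_neg]
  generalize Real.cosh θ = C, Real.sinh θ = S
  simp only [pow_two]
  ext <;> apply Complex.ext <;> simp [lor, iA, gam, sigmaA,
    QuadraticAlgebra.re_one, QuadraticAlgebra.im_one] <;> ring

lemma hasBoosts_spinM : HasBoosts spinM (gam 2) (gam 3) := by
  refine ⟨fun a b a' b' h => ?_, boostM, ?_, fun v => ⟨v, Or.inl rfl⟩, boostM_conj⟩
  · have e₀ := congrArg (fun z : HAC => z.imJ.re.im) h
    have e₁ := congrArg (fun z : HAC => z.imK.re.re) h
    simpa [gam, sigmaA, iA, QuadraticAlgebra.re_one] using And.intro e₀ e₁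
  · have : boostM = fun v => Real.cosh v • (1 : HAC) + Real.sinh v • evenProd (gam 2) (gam 3) := by
      funext v
      ext <;> simp [boostM, lor, iA, evenProd, gam, hat, hatA,
        QuadraticAlgebra.re_one, QuadraticAlgebra.im_one, mul_comm]
    rw [this]
    exact (Real.continuous_cosh.smul continuous_const).add
      (Real.continuous_sinh.smul continuous_const)

lemma exists_mul_eq_one_spinE (a : spinE) : ∃ b : spinE, a * b = 1 := by
  obtain ⟨_, v, rfl | rfl⟩ := a
  · exact ⟨⟨boostE (-v), -v, Or.inl rfl⟩, Subtype.ext (by simp [boostE_mul, boostE_zero])⟩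
  · exact ⟨⟨-boostE (-v), -v, Or.inr rfl⟩, Subtype.ext (by simp [boostE_mul, boostE_zero])⟩

lemma exists_mul_eq_one_spinM (a : spinM) : ∃ b : spinM, a * b = 1 := by
  obtain ⟨_, v, rfl | rfl⟩ := a
  · exact ⟨⟨boostM (-v), -v, Or.inl rfl⟩, Subtype.ext (by simp [boostM_mul, boostM_zero])⟩
  · exact ⟨⟨-boostM (-v), -v, Or.inr rfl⟩, Subtype.ext (by simp [boostM_mul, boostM_zero])⟩

end LorentzBundles

/-! ### The form `ξ` in local spinorial frames -/

section VecCoord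

variable {M : Type*} [TopologicalSpace M] [ChartedSpace Plane M]
  {V : M → Type*} [TopologicalSpace (TotalSpace Plane V)]
  [∀ x, AddCommGroup (V x)] [∀ x, Module ℝ (V x)] [∀ x, TopologicalSpace (V x)]
  [FiberBundle Plane V] [VectorBundle ℝ Plane V]
  {k : LorentzMetric V} {G : Submonoid HAC} {c₀ c₁ : HAC} {o : SpaceTimeOrientation k}
  {P : M → Type*} [TopologicalSpace (TotalSpace G P)] [∀ x, TopologicalSpace (P x)]
  [FiberBundle G P]

lemma vecCoord_zero {x : M} (f : Fin 2 → V x) : vecCoord k c₀ c₁ f 0 = 0 := by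
  simp [vecCoord]

lemma IsPositiveFrame.vecCoord_combination {x : M} {o : Orientation ℝ (V x) (Fin 2)}
    {fut : Set (V x)} {f : Fin 2 → V x} (hf : IsPositiveFrame k o fut f) (a b : ℝ) :
    vecCoord k c₀ c₁ f (a • f 0 + b • f 1) = a • c₀ + b • c₁ := by
  have h₀ := k.val_combination hf.1 hf.2.1 hf.2.2.1 a b 1 0
  have h₁ := k.val_combination hf.1 hf.2.1 hf.2.2.1 a b 0 1
  simp only [one_smul, zero_smul, add_zero, zero_add, mul_one, mul_zero, neg_zero] at h₀ h₁
  rw [vecCoord, h₀, h₁, neg_neg]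

lemma IsLocalSpinFrame.mdifferentiableAt {S : SpinStructure G c₀ c₁ o P} {U : Set M}
    {s : (x : M) → P x} (hs : IsLocalSpinFrame S U s) {x : M} (hx : x ∈ U) (i : Fin 2) :
    MDifferentiableAt (𝓡 2) ((𝓡 2).prod 𝓘(ℝ, Plane))
      (fun y ↦ TotalSpace.mk' Plane y (S.frame (s y) i)) x :=
  ((hs.contMDiffOn i).contMDiffAt (hs.isOpen.mem_nhds hx)).mdifferentiableAt (by simp)

lemma IsLocalSpinFrame.contMDiffOn_vecCoord {S : SpinStructure G c₀ c₁ o P} {U W : Set M}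
    {s : (x : M) → P x} (hs : IsLocalSpinFrame S U s) (hW : W ⊆ U) {v : (x : M) → V x}
    (hv : ContMDiffOn (𝓡 2) ((𝓡 2).prod 𝓘(ℝ, Plane)) ∞ (fun x ↦ TotalSpace.mk' Plane x (v x)) W) :
    ContMDiffOn (𝓡 2) 𝓘(ℝ, HAC) ∞ (fun x => vecCoord k c₀ c₁ (S.frame (s x)) (v x)) W := by
  have h := fun i => k.contMDiffOn_val hv ((hs.contMDiffOn i).mono hW)
  have h₀ := contMDiffOn_clm (ContinuousLinearMap.toSpanSingleton ℝ (-c₀)) (h 0)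
  have h₁ := contMDiffOn_clm (ContinuousLinearMap.toSpanSingleton ℝ c₁) (h 1)
  refine (h₀.add h₁).congr fun x _ => ?_
  simp [vecCoord, ContinuousLinearMap.toSpanSingleton_apply]

variable [∀ x, IsTopologicalAddGroup (V x)] [∀ x, ContinuousSMul ℝ (V x)]

/-- The derivative of the coordinate of a section in a local spinorial frame. -/
lemma IsLocalSpinFrame.vderiv_vecCoord {S : SpinStructure G c₀ c₁ o P} {U : Set M}
    {s : (x : M) → P x} (hs : IsLocalSpinFrame S U s) {cov : CovariantDerivative (𝓡 2) Plane V}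
    (hcov : IsMetricConnection k cov) {x : M} (hx : x ∈ U) {v : (x : M) → V x}
    (hv : MDifferentiableAt (𝓡 2) ((𝓡 2).prod 𝓘(ℝ, Plane))
      (fun y ↦ TotalSpace.mk' Plane y (v y)) x) :
    MDifferentiableAt (𝓡 2) 𝓘(ℝ, HAC) (fun y => vecCoord k c₀ c₁ (S.frame (s y)) (v y)) x ∧
    ∀ Z, vderiv (fun y => vecCoord k c₀ c₁ (S.frame (s y)) (v y)) x Z +
        ((connForm S cov s x Z * k.val x (v x) (S.frame (s x) 1)) • c₀ +
        (connForm S cov s x Z * -(k.val x (v x) (S.frame (s x) 0))) • c₁) =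
      vecCoord k c₀ c₁ (S.frame (s x)) (cov v x Z) := by
  have h := fun i => k.mdifferentiableAt_val hv (hs.mdifferentiableAt hx i)
  obtain ⟨d₀, e₀⟩ := vderiv_clm (ContinuousLinearMap.toSpanSingleton ℝ (-c₀)) (h 0)
  obtain ⟨d₁, e₁⟩ := vderiv_clm (ContinuousLinearMap.toSpanSingleton ℝ c₁) (h 1)
  obtain ⟨d, e⟩ := vderiv_add d₀ d₁
  have heq : (fun y => vecCoord k c₀ c₁ (S.frame (s y)) (v y)) = fun y =>
      ContinuousLinearMap.toSpanSingleton ℝ (-c₀) (k.val y (v y) (S.frame (s y) 0)) +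
      ContinuousLinearMap.toSpanSingleton ℝ c₁ (k.val y (v y) (S.frame (s y) 1)) := by
    funext y
    simp [vecCoord, ContinuousLinearMap.toSpanSingleton_apply]
  rw [heq]
  refine ⟨d, fun Z => ?_⟩
  have hf : ∀ᶠ y in 𝓝 x, IsPositiveFrame k (o.orient y) (o.future y)
      (fun i => (fun i y => S.frame (s y) i) i y) :=
    Filter.Eventually.of_forall fun y => S.frame_positive (s y)
  obtain ⟨w₀, w₁⟩ := hcov.frame_coords (f := fun i y => S.frame (s y) i) hf
    (fun i => hs.mdifferentiableAt hx i) hv Z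
  rw [e, e₀, e₁, vecCoord, w₀, w₁, connForm]
  simp only [ContinuousLinearMap.toSpanSingleton_apply]
  module

end VecCoord

/-! ### The form ξ on the surface: independence of frames, isometry, Leibniz rule. -/

section Surface

variable {M : Type*} [TopologicalSpace M] [ChartedSpace Plane M] [IsManifold (𝓡 2) ∞ M]
  {E : M → Type*} [TopologicalSpace (TotalSpace Plane E)]
  [∀ x, AddCommGroup (E x)] [∀ x, Module ℝ (E x)] [∀ x, TopologicalSpace (E x)]
  [FiberBundle Plane E] [VectorBundle ℝ Plane E]
  {g : LorentzMetric (TangentSpace (𝓡 2) : M → Type _)} {h : LorentzMetric E}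
  {oM : SpaceTimeOrientation g} {oE : SpaceTimeOrientation h}
  {PE : M → Type*} [TopologicalSpace (TotalSpace spinE PE)] [∀ x, TopologicalSpace (PE x)]
  [FiberBundle spinE PE]
  {PM : M → Type*} [TopologicalSpace (TotalSpace spinM PM)] [∀ x, TopologicalSpace (PM x)]
  [FiberBundle spinM PM]
  {SE : SpinStructure spinE (gam 0) (gam 1) oE PE} {SM : SpinStructure spinM (gam 2) (gam 3) oM PM}
  {φ : SpinorField SE SM}

lemma oddCoord_eq_emb {x : M} (p : PE x) (q : PM x) (ν : E x) (X : TangentSpace (𝓡 2) x) :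
    oddCoord SE SM p q ν X = emb ![-(h.val x ν (SE.frame p 0)), h.val x ν (SE.frame p 1),
      -(g.val x X (SM.frame q 0)), g.val x X (SM.frame q 1)] :=
  smul_gam_add _ _ _ _

lemma oddCoord_zero_right {x : M} (p : PE x) (q : PM x) (ν : E x) :
    oddCoord SE SM p q ν 0 = (-(h.val x ν (SE.frame p 0))) • gam 0 +
      h.val x ν (SE.frame p 1) • gam 1 := by
  rw [oddCoord, vecCoord_zero, add_zero, vecCoord]

lemma oddCoord_zero_left {x : M} (p : PE x) (q : PM x) (X : TangentSpace (𝓡 2) x) :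
    oddCoord SE SM p q 0 X = (-(g.val x X (SM.frame q 0))) • gam 2 +
      g.val x X (SM.frame q 1) • gam 3 := by
  rw [oddCoord, vecCoord_zero, zero_add, vecCoord]

lemma oddCoord_combination_left {x : M} (p : PE x) (q : PM x) (a b : ℝ) :
    oddCoord SE SM p q (a • SE.frame p 0 + b • SE.frame p 1) 0 = a • gam 0 + b • gam 1 := by
  rw [oddCoord, vecCoord_zero, add_zero, (SE.frame_positive p).vecCoord_combination]

lemma oddCoord_combination_right {x : M} (p : PE x) (q : PM x) (a b : ℝ) :
    oddCoord SE SM p q 0 (a • SM.frame q 0 + b • SM.frame q 1) = a • gam 2 + b • gam 3 := by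
  rw [oddCoord, vecCoord_zero, zero_add, (SM.frame_positive q).vecCoord_combination]

lemma SpinorField.xi_eq {x : M} (p : PE x) (q : PM x) (ν : E x) (X : TangentSpace (𝓡 2) x) :
    φ.xi p q ν X = xiQ (φ.coord p q) (oddCoord SE SM p q ν X) :=
  pairing_cliffordOdd _ _

lemma SpinorField.xi_act {x : M} (p : PE x) (q : PM x) (a : spinE) (b : spinM) (ν : E x)
    (X : TangentSpace (𝓡 2) x) : φ.xi (SE.act p a) (SM.act q b) ν X = φ.xi p q ν X := by
  rw [φ.xi_eq, φ.xi_eq, φ.equivariant p q a b, oddCoord, oddCoord, SE.frame_act p a,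
    SM.frame_act q b, vecCoord, vecCoord, xiQ_spin]

/-- The form `ξ` does not depend on the spinorial frame. -/
lemma SpinorField.xi_congr {x : M} (p p' : PE x) (q q' : PM x) (ν : E x)
    (X : TangentSpace (𝓡 2) x) : φ.xi p' q' ν X = φ.xi p q ν X := by
  obtain ⟨a, rfl⟩ := SE.exists_act_eq exists_mul_eq_one_spinE p p'
  obtain ⟨b, rfl⟩ := SM.exists_act_eq exists_mul_eq_one_spinM q q'
  exact φ.xi_act p q a b ν X

lemma SpinorField.tau_coord {x : M} (p : PE x) (q : PM x) : tau (φ.coord p q) = φ.coord p q :=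
  tau_eq_of_mem_H0 (φ.mem_H0 p q)

lemma SpinorField.emb_toR22_xi {x : M} (p : PE x) (q : PM x) (ν : E x)
    (X : TangentSpace (𝓡 2) x) : emb (toR22 (φ.xi p q ν X)) = φ.xi p q ν X := by
  rw [φ.xi_eq, oddCoord_eq_emb]
  exact emb_toR22_xiQ (φ.tau_coord p q) _

/-- `ξ` is isometric. -/
lemma SpinorField.IsNormalized.form22_eq (hφ : φ.IsNormalized) {x : M} {p : PE x} {q : PM x}
    {ν μ : E x} {X Y : TangentSpace (𝓡 2) x} {w w' : R22} (hw : emb w = φ.xi p q ν X)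
    (hw' : emb w' = φ.xi p q μ Y) : form22 w w' = h.val x ν μ + g.val x X Y := by
  rw [← realProd_emb, hw, hw', realProd, φ.xi_eq, φ.xi_eq, formH_xiQ (hφ x p q), oddCoord_eq_emb,
    oddCoord_eq_emb, formH_emb, (SE.frame_positive p).val_eq ν μ, (SM.frame_positive q).val_eq X Y]
  simp [lor, form22]
  ring

/-- `ξ` is onto `ℝ^{2,2}`. -/
lemma SpinorField.IsNormalized.exists_xi_eq (hφ : φ.IsNormalized) {x : M} (p : PE x) (q : PM x)
    (w : R22) : ∃ (ν : E x) (X : TangentSpace (𝓡 2) x), φ.xi p q ν X = emb w := by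
  obtain ⟨y, hy⟩ := exists_xiQ_eq_emb (hφ x p q) (φ.tau_coord p q) w
  refine ⟨y 0 • SE.frame p 0 + y 1 • SE.frame p 1, y 2 • SM.frame q 0 + y 3 • SM.frame q 1, ?_⟩
  rw [φ.xi_eq, oddCoord, (SE.frame_positive p).vecCoord_combination,
    (SM.frame_positive q).vecCoord_combination, smul_gam_add, ← hy]
  congr 2
  ext i; fin_cases i <;> rfl

section LocalFrame

variable {U : Set M} {s : (x : M) → PE x} {t : (x : M) → PM x}

lemma SpinorField.contMDiffOn_xi (φ : SpinorField SE SM) (hs : IsLocalSpinFrame SE U s)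
    (ht : IsLocalSpinFrame SM U t) {W : Set M} (hW : W ⊆ U)
    {ν : (x : M) → E x} {Y : (x : M) → TangentSpace (𝓡 2) x}
    (hν : ContMDiffOn (𝓡 2) ((𝓡 2).prod 𝓘(ℝ, Plane)) ∞ (fun x ↦ TotalSpace.mk' Plane x (ν x)) W)
    (hY : ContMDiffOn (𝓡 2) ((𝓡 2).prod 𝓘(ℝ, Plane)) ∞ (fun x ↦ TotalSpace.mk' Plane x (Y x)) W) :
    ContMDiffOn (𝓡 2) 𝓘(ℝ, HAC) ∞ (fun x => φ.xi (s x) (t x) (ν x) (Y x)) W := by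
  have h₁ := contMDiffOn_xiQ ((φ.contMDiffOn U s t hs ht).mono hW)
    ((hs.contMDiffOn_vecCoord hW hν).add (ht.contMDiffOn_vecCoord hW hY))
  exact h₁.congr fun x _ => φ.xi_eq _ _ _ _

lemma SpinorField.mdifferentiableAt_coord (φ : SpinorField SE SM) (hs : IsLocalSpinFrame SE U s)
    (ht : IsLocalSpinFrame SM U t) {x : M} (hx : x ∈ U) :
    MDifferentiableAt (𝓡 2) 𝓘(ℝ, HAC) (fun y => φ.coord (s y) (t y)) x :=
  ((φ.contMDiffOn U s t hs ht).contMDiffAt (hs.isOpen.mem_nhds hx)).mdifferentiableAt (by simp)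

variable [∀ x, IsTopologicalAddGroup (E x)] [∀ x, ContinuousSMul ℝ (E x)]
  (covE : CovariantDerivative (𝓡 2) Plane E)
  (covM : CovariantDerivative (𝓡 2) Plane (TangentSpace (𝓡 2) : M → Type _))

lemma SpinorField.vderiv_coord (x : M) (Z : TangentSpace (𝓡 2) x) :
    vderiv (fun y => φ.coord (s y) (t y)) x Z = φ.nabla covE covM s t x Z +
      connQuat (connForm SE covE s x Z) (connForm SM covM t x Z) * φ.coord (s x) (t x) := by
  rw [SpinorField.nabla, connQuat, add_mul, smul_mul_assoc, smul_mul_assoc]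
  change _ = vderiv (fun y => φ.coord (s y) (t y)) x Z - _ - _ + _
  abel

lemma SpinorField.nabla_combination (x : M) (Z W : TangentSpace (𝓡 2) x) (a b : ℝ) :
    φ.nabla covE covM s t x (a • Z + b • W) =
      a • φ.nabla covE covM s t x Z + b • φ.nabla covE covM s t x W := by
  have hd := fun Z => eq_sub_of_add_eq (φ.vderiv_coord (s := s) (t := t) covE covM x Z).symm
  rw [hd, hd, hd]
  simp only [connForm, connQuat, map_add, map_smul, add_apply, smul_apply, smul_eq_mul, add_mul,
    smul_mul_assoc]
  module

/-- Differentiating the invariance of the coordinate under `tau`; the connection term is itself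
invariant. -/
lemma SpinorField.tau_nabla (hs : IsLocalSpinFrame SE U s) (ht : IsLocalSpinFrame SM U t) {x : M}
    (hx : x ∈ U) (Z : TangentSpace (𝓡 2) x) :
    tau (φ.nabla covE covM s t x Z) = φ.nabla covE covM s t x Z := by
  have h₁ := (vderiv_clm tauL (φ.mdifferentiableAt_coord hs ht hx)).2 Z
  simp only [tauL_apply, φ.tau_coord] at h₁
  rw [φ.vderiv_coord covE covM, tau_add, tau_mul, tau_connQuat, φ.tau_coord] at h₁
  exact (add_right_cancel h₁).symm

/-- The derivative of ζ̄ζ = 1. The connection terms cancel because `connQuat` is purely imaginary.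
-/
lemma SpinorField.IsNormalized.star_nabla (hφ : φ.IsNormalized) (hs : IsLocalSpinFrame SE U s)
    (ht : IsLocalSpinFrame SM U t) {x : M} (hx : x ∈ U) (Z : TangentSpace (𝓡 2) x) :
    star (φ.nabla covE covM s t x Z) * φ.coord (s x) (t x) +
      star (φ.coord (s x) (t x)) * φ.nabla covE covM s t x Z = 0 := by
  have hd := φ.mdifferentiableAt_coord hs ht hx
  obtain ⟨d₁, e₁⟩ := vderiv_clm conjL hd
  have h₁ := (vderiv_bilin mulL d₁ hd).2 Z
  rw [e₁] at h₁
  simp only [conjL_apply, mulL_apply] at h₁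
  have h₂ : (fun y => star (φ.coord (s y) (t y)) * φ.coord (s y) (t y)) = fun _ => (1 : HAC) :=
    funext fun y => star_mul_self_eq_one (hφ y _ _)
  rw [h₂, vderiv_const, φ.vderiv_coord covE covM, star_add, star_mul, star_connQuat] at h₁
  have h₃ : (0 : HAC) = star (φ.nabla covE covM s t x Z) * φ.coord (s x) (t x) +
      star (φ.coord (s x) (t x)) * φ.nabla covE covM s t x Z := by
    refine h₁.trans ?_
    noncomm_ring
  exact h₃.symm

variable {covE covM}

/-- `∂_Z ξ(ν + Y) = ξ(∇_Z(ν + Y)) + ⟨⟨(ν + Y)·∇_Z φ, φ⟩⟩ + ⟨⟨(ν + Y)·φ, ∇_Z φ⟩⟩`. -/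
lemma SpinorField.vderiv_xi (φ : SpinorField SE SM) (hcovE : IsMetricConnection h covE)
    (hcovM : IsMetricConnection g covM) (hs : IsLocalSpinFrame SE U s)
    (ht : IsLocalSpinFrame SM U t) {x : M} (hx : x ∈ U)
    {ν : (x : M) → E x} {Y : (x : M) → TangentSpace (𝓡 2) x}
    (hν : MDifferentiableAt (𝓡 2) ((𝓡 2).prod 𝓘(ℝ, Plane))
      (fun y ↦ TotalSpace.mk' Plane y (ν y)) x)
    (hY : MDifferentiableAt (𝓡 2) ((𝓡 2).prod 𝓘(ℝ, Plane))
      (fun y ↦ TotalSpace.mk' Plane y (Y y)) x) :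
    MDifferentiableAt (𝓡 2) 𝓘(ℝ, HAC) (fun y => φ.xi (s y) (t y) (ν y) (Y y)) x ∧
    ∀ Z, vderiv (fun y => φ.xi (s y) (t y) (ν y) (Y y)) x Z =
      φ.xi (s x) (t x) (covE ν x Z) (covM Y x Z) -
        (star (φ.nabla covE covM s t x Z) * oddCoord SE SM (s x) (t x) (ν x) (Y x)
            * hat (φ.coord (s x) (t x)) +
          star (φ.coord (s x) (t x)) * oddCoord SE SM (s x) (t x) (ν x) (Y x)
            * hat (φ.nabla covE covM s t x Z)) := by
  obtain ⟨d₁, e₁⟩ := hs.vderiv_vecCoord hcovE hx hν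
  obtain ⟨d₂, e₂⟩ := ht.vderiv_vecCoord hcovM hx hY
  obtain ⟨d₃, e₃⟩ := vderiv_add d₁ d₂
  obtain ⟨d₄, e₄⟩ := vderiv_xiQ (φ.mdifferentiableAt_coord hs ht hx) d₃
  have heq : (fun y => φ.xi (s y) (t y) (ν y) (Y y)) = fun y => xiQ (φ.coord (s y) (t y))
      (vecCoord h (gam 0) (gam 1) (SE.frame (s y)) (ν y) +
        vecCoord g (gam 2) (gam 3) (SM.frame (t y)) (Y y)) :=
    funext fun y => φ.xi_eq _ _ _ _
  rw [heq]
  refine ⟨d₄, fun Z => ?_⟩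
  rw [e₄, φ.vderiv_coord covE covM, e₃, φ.xi_eq]
  have hc := connQuat_commutator (connForm SE covE s x Z) (connForm SM covM t x Z)
    (-(h.val x (ν x) (SE.frame (s x) 0)))
    (h.val x (ν x) (SE.frame (s x) 1)) (-(g.val x (Y x) (SM.frame (t x) 0)))
    (g.val x (Y x) (SM.frame (t x) 1))
  rw [← vecCoord, ← vecCoord] at hc
  rw [xiQ_leibniz (star_connQuat _ _) hc, oddCoord, oddCoord, ← e₁ Z, ← e₂ Z]
  congr 2
  abel

end LocalFrame
end Surface

/-! ### The Dirac equation and the second fundamental form -/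

section SecondFundamentalForm

variable {M : Type*} [TopologicalSpace M] [ChartedSpace Plane M] [IsManifold (𝓡 2) ∞ M]
  {E : M → Type*} [TopologicalSpace (TotalSpace Plane E)]
  [∀ x, AddCommGroup (E x)] [∀ x, Module ℝ (E x)] [∀ x, TopologicalSpace (E x)]
  [∀ x, IsTopologicalAddGroup (E x)] [∀ x, ContinuousSMul ℝ (E x)]
  [FiberBundle Plane E] [VectorBundle ℝ Plane E]
  {g : LorentzMetric (TangentSpace (𝓡 2) : M → Type _)} {h : LorentzMetric E}
  {oM : SpaceTimeOrientation g} {oE : SpaceTimeOrientation h}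
  {PE : M → Type*} [TopologicalSpace (TotalSpace spinE PE)] [∀ x, TopologicalSpace (PE x)]
  [FiberBundle spinE PE]
  {PM : M → Type*} [TopologicalSpace (TotalSpace spinM PM)] [∀ x, TopologicalSpace (PM x)]
  [FiberBundle spinM PM]
  {SE : SpinStructure spinE (gam 0) (gam 1) oE PE} {SM : SpinStructure spinM (gam 2) (gam 3) oM PM}
  {φ : SpinorField SE SM}
  {covE : CovariantDerivative (𝓡 2) Plane E}
  {covM : CovariantDerivative (𝓡 2) Plane (TangentSpace (𝓡 2) : M → Type _)}
  {Hvec : (x : M) → E x} {U : Set M} {s : (x : M) → PE x} {t : (x : M) → PM x}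

/-- The covariant derivatives of a normalized solution of the Dirac equation. -/
lemma SpinorField.IsDiracSolution.exists_nabla_eq (hD : φ.IsDiracSolution covE covM Hvec)
    (hφ : φ.IsNormalized) (hs : IsLocalSpinFrame SE U s) (ht : IsLocalSpinFrame SM U t) {x : M}
    (hx : x ∈ U) : ∃ p r a b c d : ℝ, ∀ (Z : TangentSpace (𝓡 2) x) (y₂ y₃ : ℝ),
      y₂ = -(g.val x Z (SM.frame (t x) 0)) → y₃ = g.val x Z (SM.frame (t x) 1) →
      φ.nabla covE covM s t x Z =
        quatJK (y₂ * p + y₃ * c) (y₂ * a + y₃ * r) (y₂ * b + y₃ * p) (y₂ * r + y₃ * d) *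
          φ.coord (s x) (t x) := by
  have hDx := hD U s t hs ht x hx
  rw [oddCoord_zero_right] at hDx
  obtain ⟨p, r, a, b, c, d, h₂, h₃⟩ := exists_quatJK_of_dirac (hφ x _ _) (φ.tau_coord _ _)
    (φ.tau_nabla covE covM hs ht hx _) (φ.tau_nabla covE covM hs ht hx _)
    (hφ.star_nabla covE covM hs ht hx _) (hφ.star_nabla covE covM hs ht hx _) hDx
  refine ⟨p, r, a, b, c, d, fun Z y₂ y₃ e₂ e₃ => ?_⟩
  conv_lhs => rw [(SM.frame_positive (t x)).eq_combination Z, ← e₂, ← e₃]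
  rw [φ.nabla_combination, h₂, h₃, ← quatJK_smul_add, add_mul, smul_mul_assoc, smul_mul_assoc]

/-- The variation of `ξ` on `E` is tangent. -/
lemma SpinorField.IsDiracSolution.exists_tangent (hD : φ.IsDiracSolution covE covM Hvec)
    (hφ : φ.IsNormalized) (hs : IsLocalSpinFrame SE U s) (ht : IsLocalSpinFrame SM U t) {x : M}
    (hx : x ∈ U) (ν : E x) (Z : TangentSpace (𝓡 2) x) : ∃ W : TangentSpace (𝓡 2) x,
      -(star (φ.nabla covE covM s t x Z) * oddCoord SE SM (s x) (t x) ν 0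
            * hat (φ.coord (s x) (t x)) +
          star (φ.coord (s x) (t x)) * oddCoord SE SM (s x) (t x) ν 0
            * hat (φ.nabla covE covM s t x Z)) = φ.xi (s x) (t x) 0 W := by
  obtain ⟨p, r, a, b, c, d, hn⟩ := hD.exists_nabla_eq hφ hs ht hx
  rw [hn Z _ _ rfl rfl, xiQ_variation _ (star_quatJK _ _ _ _), oddCoord_zero_right, quatJK_normal,
    ← oddCoord_combination_right (SE := SE) (SM := SM) (s x) (t x), ← φ.xi_eq]
  exact ⟨_, rfl⟩

/-- The variation of `ξ` on `TM` is normal, and it is given by a symmetric bilinear map. -/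
lemma SpinorField.IsDiracSolution.exists_bilinear (hD : φ.IsDiracSolution covE covM Hvec)
    (hφ : φ.IsNormalized) (hs : IsLocalSpinFrame SE U s) (ht : IsLocalSpinFrame SM U t) {x : M}
    (hx : x ∈ U) : ∃ B : TangentSpace (𝓡 2) x →L[ℝ] TangentSpace (𝓡 2) x →L[ℝ] E x,
      (∀ X Z, B X Z = B Z X) ∧
      (∀ X Z, -(star (φ.nabla covE covM s t x Z) * oddCoord SE SM (s x) (t x) 0 X
            * hat (φ.coord (s x) (t x)) +
          star (φ.coord (s x) (t x)) * oddCoord SE SM (s x) (t x) 0 X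
            * hat (φ.nabla covE covM s t x Z)) = φ.xi (s x) (t x) (B X Z) 0) ∧
      ∀ X Z ν, h.val x (B X Z) ν = -2 * realProd
          (cliffordOdd (oddCoord SE SM (s x) (t x) 0 X) (φ.nabla covE covM s t x Z))
          (cliffordOdd (oddCoord SE SM (s x) (t x) ν 0) (φ.coord (s x) (t x))) := by
  obtain ⟨p, r, a, b, c, d, hn⟩ := hD.exists_nabla_eq hφ hs ht hx
  set e₀ := SE.frame (s x) 0 with he₀
  set e₁ := SE.frame (s x) 1 with he₁
  set l₂ : TangentSpace (𝓡 2) x →L[ℝ] ℝ := -(g.val x (SM.frame (t x) 0)) with hl₂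
  set l₃ : TangentSpace (𝓡 2) x →L[ℝ] ℝ := g.val x (SM.frame (t x) 1) with hl₃
  have hl₂' : ∀ Z, l₂ Z = -(g.val x Z (SM.frame (t x) 0)) := fun Z => by
    rw [g.symm x Z, hl₂, neg_apply]
  have hl₃' : ∀ Z, l₃ Z = g.val x Z (SM.frame (t x) 1) := fun Z => by rw [g.symm x Z, hl₃]
  -- The values of B on the frame vectors, read off from `quatJK_tangent`. The mixed value v₂₃
  -- serves twice because p and r are shared by ∇_{e₂}φ and ∇_{e₃}φ; this is the symmetry of B.
  set v₂₂ : E x := (2 * a) • e₀ + (-2 * b) • e₁ with hv₂₂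
  set v₂₃ : E x := (2 * r) • e₀ + (-2 * p) • e₁ with hv₂₃
  set v₃₃ : E x := (2 * d) • e₀ + (-2 * c) • e₁ with hv₃₃
  set B : TangentSpace (𝓡 2) x →L[ℝ] TangentSpace (𝓡 2) x →L[ℝ] E x :=
    l₂.smulRight (l₂.smulRight v₂₂ + l₃.smulRight v₂₃) +
      l₃.smulRight (l₂.smulRight v₂₃ + l₃.smulRight v₃₃) with hB
  have hBv : ∀ X Z, B X Z =
      (2 * (l₂ X * (l₂ Z * a + l₃ Z * r) + l₃ X * (l₂ Z * r + l₃ Z * d))) • e₀ +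
        (-2 * (l₂ X * (l₂ Z * b + l₃ Z * p) + l₃ X * (l₂ Z * p + l₃ Z * c))) • e₁ := by
    intro X Z
    simp only [hB, add_apply, smul_apply, ContinuousLinearMap.smulRight_apply, hv₂₂, hv₂₃, hv₃₃]
    module
  refine ⟨B, fun X Z => ?_, fun X Z => ?_, fun X Z ν => ?_⟩
  · rw [hBv, hBv]
    congr 2 <;> ring
  · rw [hn Z _ _ (hl₂' Z) (hl₃' Z), xiQ_variation _ (star_quatJK _ _ _ _), oddCoord_zero_left,
      ← hl₂', ← hl₃', quatJK_tangent, φ.xi_eq, hBv, oddCoord_combination_left]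
  · have hP := SE.frame_positive (s x)
    have h₂ := two_realProd_quatJK (l₂ X) (l₃ X) (-(h.val x ν e₀)) (h.val x ν e₁)
      (l₂ Z * p + l₃ Z * c) (l₂ Z * a + l₃ Z * r) (l₂ Z * b + l₃ Z * p) (l₂ Z * r + l₃ Z * d)
    rw [hn Z _ _ (hl₂' Z) (hl₃' Z), realProd_cliffordOdd (hφ x _ _), oddCoord_zero_left,
      oddCoord_zero_right, ← hl₂', ← hl₃', mul_neg, neg_mul, neg_neg, h₂, hBv, h.symm]
    simp only [map_add, map_smul, smul_eq_mul]
    ring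

end SecondFundamentalForm

end SpinR22

end

/-! ### The theorem, assembled from the pointwise algebra and the local calculus. -/

open SpinR22 in
theorem theorem2
    {M : Type*} [TopologicalSpace M] [T2Space M] [SecondCountableTopology M]
    [ChartedSpace SpinR22.Plane M] [IsManifold (𝓡 2) ∞ M]
    {E : M → Type*} [TopologicalSpace (TotalSpace SpinR22.Plane E)]
    [∀ x, AddCommGroup (E x)] [∀ x, Module ℝ (E x)] [∀ x, TopologicalSpace (E x)]
    [∀ x, IsTopologicalAddGroup (E x)] [∀ x, ContinuousSMul ℝ (E x)]
    [FiberBundle SpinR22.Plane E] [VectorBundle ℝ SpinR22.Plane E]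
    [ContMDiffVectorBundle ∞ SpinR22.Plane E (𝓡 2)]
    -- the Lorentzian metrics on `TM` and `E`, the Levi-Civita connection of `M` and a metric
    -- connection on `E`
    (g : SpinR22.LorentzMetric (TangentSpace (𝓡 2) : M → Type _))
    (h : SpinR22.LorentzMetric E)
    (covM : CovariantDerivative (𝓡 2) SpinR22.Plane (TangentSpace (𝓡 2) : M → Type _))
    (hcovM : SpinR22.IsLeviCivita g covM)
    (covE : CovariantDerivative (𝓡 2) SpinR22.Plane E)
    (hcovE : SpinR22.IsMetricConnection h covE)
    -- the orientations and the spin structures of `TM` and `E`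
    (oM : SpinR22.SpaceTimeOrientation g) (oE : SpinR22.SpaceTimeOrientation h)
    {PE : M → Type*} [TopologicalSpace (TotalSpace SpinR22.spinE PE)]
    [∀ x, TopologicalSpace (PE x)] [FiberBundle SpinR22.spinE PE]
    (SE : SpinR22.SpinStructure SpinR22.spinE (SpinR22.gam 0) (SpinR22.gam 1) oE PE)
    {PM : M → Type*} [TopologicalSpace (TotalSpace SpinR22.spinM PM)]
    [∀ x, TopologicalSpace (PM x)] [FiberBundle SpinR22.spinM PM]
    (SM : SpinR22.SpinStructure SpinR22.spinM (SpinR22.gam 2) (SpinR22.gam 3) oM PM)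
    -- a normalized solution `φ` of the Dirac equation `Dφ = H⃗ · φ`
    (Hvec : (x : M) → E x) (φ : SpinR22.SpinorField SE SM)
    (hφ : φ.IsDiracSolution covE covM Hvec) (hφ₁ : φ.IsNormalized)
    -- a primitive `F` of `ξ`
    (F : M → SpinR22.R22) (hF : MDifferentiable (𝓡 2) 𝓘(ℝ, SpinR22.R22) F)
    (hFξ : ∀ (x : M) (p : PE x) (q : PM x) (X : TangentSpace (𝓡 2) x),
      SpinR22.emb (SpinR22.diff F x X) = φ.xi p q 0 X) :
    SpinR22.IsIsometricImmersion g F ∧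
    -- `Φ x` is the map `ν ↦ ξ(ν)` from `E x` to `ℝ^{2,2}`
    ∃ Φ : (x : M) → E x →L[ℝ] SpinR22.R22,
      (∀ (x : M) (p : PE x) (q : PM x) (ν : E x), SpinR22.emb (Φ x ν) = φ.xi p q ν 0) ∧
      -- it is smooth
      (∀ (U : Set M) (ν : (x : M) → E x), IsOpen U →
        ContMDiffOn (𝓡 2) ((𝓡 2).prod 𝓘(ℝ, SpinR22.Plane)) ∞
          (fun x ↦ TotalSpace.mk' SpinR22.Plane x (ν x)) U →
        ContMDiffOn (𝓡 2) 𝓘(ℝ, SpinR22.R22) ∞ (fun x ↦ Φ x (ν x)) U) ∧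
      -- it is an isometry from `E` onto the normal bundle
      (∀ x : M, Set.BijOn (Φ x) Set.univ (SpinR22.normalSpace F x)) ∧
      (∀ (x : M) (ν μ : E x), SpinR22.form22 (Φ x ν) (Φ x μ) = h.val x ν μ) ∧
      -- it preserves the connections
      (∀ (ν : (x : M) → E x) (x : M),
        MDifferentiableAt (𝓡 2) ((𝓡 2).prod 𝓘(ℝ, SpinR22.Plane))
          (fun y ↦ TotalSpace.mk' SpinR22.Plane y (ν y)) x →
        MDifferentiableAt (𝓡 2) 𝓘(ℝ, SpinR22.R22) (fun y ↦ Φ y (ν y)) x ∧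
        ∀ X : TangentSpace (𝓡 2) x,
          SpinR22.IsNormalPart F x (SpinR22.diff (fun y ↦ Φ y (ν y)) x X)
            (Φ x (covE ν x X))) ∧
      -- it maps the second fundamental form `B` defined by `φ` to that of `F`
      ∃ B : (x : M) → TangentSpace (𝓡 2) x →L[ℝ] TangentSpace (𝓡 2) x →L[ℝ] E x,
        φ.IsSecondFundamentalForm covE covM B ∧
        ∀ (Y : (x : M) → TangentSpace (𝓡 2) x) (x : M),
          MDifferentiableAt (𝓡 2) ((𝓡 2).prod 𝓘(ℝ, SpinR22.Plane))
            (fun y ↦ TotalSpace.mk' SpinR22.Plane y (Y y)) x →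
          MDifferentiableAt (𝓡 2) 𝓘(ℝ, SpinR22.R22) (fun y ↦ SpinR22.diff F y (Y y)) x ∧
          ∀ X : TangentSpace (𝓡 2) x,
            SpinR22.diff (fun y ↦ SpinR22.diff F y (Y y)) x X =
              SpinR22.diff F x (covM Y x X) + Φ x (B x X (Y x)) := by
  have hE : ∀ x, Nonempty (PE x) := fun x => nonempty_principal_fibre spinE x
  have hM : ∀ x, Nonempty (PM x) := fun x => nonempty_principal_fibre spinM x
  have local_frames : ∀ x₀ : M, ∃ (U : Set M) (s : (x : M) → PE x) (t : (x : M) → PM x), x₀ ∈ U ∧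
      IsLocalSpinFrame SE U s ∧ IsLocalSpinFrame SM U t := by
    intro x₀
    obtain ⟨U, s, hx, hs⟩ := SE.exists_isLocalSpinFrame hasBoosts_spinE x₀
    obtain ⟨U', t, hx', ht⟩ := SM.exists_isLocalSpinFrame hasBoosts_spinM x₀
    have ho := hs.isOpen.inter ht.isOpen
    exact ⟨U ∩ U', s, t, ⟨hx, hx'⟩,
      ⟨ho, hs.continuousOn.mono Set.inter_subset_left,
        fun i => (hs.contMDiffOn i).mono Set.inter_subset_left⟩,
      ⟨ho, ht.continuousOn.mono Set.inter_subset_right,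
        fun i => (ht.contMDiffOn i).mono Set.inter_subset_right⟩⟩
  have diff_eq : ∀ (x : M) (p : PE x) (q : PM x) (X : TangentSpace (𝓡 2) x),
      diff F x X = toR22L (φ.xi p q 0 X) := fun x p q X => by
    rw [← hFξ x p q X, toR22L_apply, toR22_emb]
  have zero_smooth : ContMDiff (𝓡 2) ((𝓡 2).prod 𝓘(ℝ, Plane)) ∞
      (fun x : M ↦ TotalSpace.mk' Plane x (0 : E x)) := contMDiff_zeroSection ℝ E
  have zero_smooth' : ContMDiff (𝓡 2) ((𝓡 2).prod 𝓘(ℝ, Plane)) ∞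
      (fun x : M ↦ TotalSpace.mk' Plane x (0 : TangentSpace (𝓡 2) x)) :=
    contMDiff_zeroSection ℝ (TangentSpace (𝓡 2) : M → Type _)
  have F_smooth : ContMDiff (𝓡 2) 𝓘(ℝ, R22) ∞ F := by
    refine contMDiff_of_vderiv hF fun x₀ => ?_
    obtain ⟨U, s, t, hx, hs, ht⟩ := local_frames x₀
    refine ⟨U, hs.isOpen, hx, fun W hW Y _ hY => ?_⟩
    refine (contMDiffOn_clm toR22L (φ.contMDiffOn_xi hs ht hW zero_smooth.contMDiffOn hY)).congr ?_
    intro y _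
    exact diff_eq y (s y) (t y) (Y y)
  have F_isom : ∀ x (X Y : TangentSpace (𝓡 2) x),
      form22 (diff F x X) (diff F x Y) = g.val x X Y := by
    intro x X Y
    obtain ⟨p⟩ := hE x
    obtain ⟨q⟩ := hM x
    rw [hφ₁.form22_eq (hFξ x p q X) (hFξ x p q Y)]
    simp
  have nondeg : ∀ x (X : TangentSpace (𝓡 2) x), (∀ Y, g.val x X Y = 0) → X = 0 := by
    intro x X hX
    obtain ⟨q⟩ := hM x
    exact (SM.frame_positive q).ext (by rw [hX]; simp) (by rw [hX]; simp)
  -- The map is built from an arbitrary spinorial frame at each point; independence of the frame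
  -- then allows any smooth local one in the differentiations.
  have hΦ : ∀ x, ∃ Φ : E x →L[ℝ] R22, ∀ ν, Φ ν = toR22L (φ.xi (hE x).some (hM x).some ν 0) := by
    intro x
    refine ⟨(-(h.val x (SE.frame (hE x).some 0))).smulRight
      (toR22L (xiQ (φ.coord (hE x).some (hM x).some) (gam 0))) +
      (h.val x (SE.frame (hE x).some 1)).smulRight
      (toR22L (xiQ (φ.coord (hE x).some (hM x).some) (gam 1))), fun ν => ?_⟩
    rw [φ.xi_eq, oddCoord_zero_right, xiQ_add, xiQ_smul, xiQ_smul, map_add, map_smul, map_smul,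
      h.symm x ν, h.symm x ν]
    rfl
  choose Φ hΦ' using hΦ
  have Φ_eq : ∀ (x : M) (p : PE x) (q : PM x) (ν : E x), Φ x ν = toR22L (φ.xi p q ν 0) := by
    intro x p q ν
    rw [hΦ', φ.xi_congr p _ q]
  have Φ_emb : ∀ (x : M) (p : PE x) (q : PM x) (ν : E x), emb (Φ x ν) = φ.xi p q ν 0 := by
    intro x p q ν
    rw [Φ_eq x p q, toR22L_apply, φ.emb_toR22_xi]
  have Φ_isom : ∀ (x : M) (ν μ : E x), form22 (Φ x ν) (Φ x μ) = h.val x ν μ := by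
    intro x ν μ
    obtain ⟨p⟩ := hE x
    obtain ⟨q⟩ := hM x
    rw [hφ₁.form22_eq (Φ_emb x p q ν) (Φ_emb x p q μ)]
    simp
  have Φ_normal : ∀ (x : M) (ν : E x), Φ x ν ∈ normalSpace F x := by
    intro x ν X
    obtain ⟨p⟩ := hE x
    obtain ⟨q⟩ := hM x
    rw [hφ₁.form22_eq (Φ_emb x p q ν) (hFξ x p q X)]
    simp
  have Φ_inj : ∀ x : M, Function.Injective (Φ x) := by
    intro x ν μ hνμ
    obtain ⟨p⟩ := hE x
    exact (SE.frame_positive p).ext (by rw [← Φ_isom, hνμ, Φ_isom]) (by rw [← Φ_isom, hνμ, Φ_isom])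
  have Φ_surj : ∀ (x : M), ∀ w ∈ normalSpace F x, ∃ ν, Φ x ν = w := by
    intro x w hw
    obtain ⟨p⟩ := hE x
    obtain ⟨q⟩ := hM x
    obtain ⟨ν, X, hνX⟩ := hφ₁.exists_xi_eq p q w
    -- Here w = ξ(ν + X), and since ξ is isometric, w is normal only if X is orthogonal to all of
    -- the tangent plane.
    have hX : X = 0 := nondeg x X fun Y => by
      have h₁ := hw Y
      rw [hφ₁.form22_eq hνX.symm (hFξ x p q Y)] at h₁
      simpa using h₁
    refine ⟨ν, ?_⟩
    rw [Φ_eq x p q, ← hX, hνX, toR22L_apply, toR22_emb]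
  have deriv_dF : ∀ (U : Set M) (s : (x : M) → PE x) (t : (x : M) → PM x),
      IsLocalSpinFrame SE U s → IsLocalSpinFrame SM U t → ∀ x ∈ U,
      ∃ B : TangentSpace (𝓡 2) x →L[ℝ] TangentSpace (𝓡 2) x →L[ℝ] E x,
      (∀ X Z ν, h.val x (B X Z) ν = -2 * realProd
          (cliffordOdd (oddCoord SE SM (s x) (t x) 0 X) (φ.nabla covE covM s t x Z))
          (cliffordOdd (oddCoord SE SM (s x) (t x) ν 0) (φ.coord (s x) (t x)))) ∧
      ∀ Y : (x : M) → TangentSpace (𝓡 2) x,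
        MDifferentiableAt (𝓡 2) ((𝓡 2).prod 𝓘(ℝ, Plane)) (fun y ↦ TotalSpace.mk' Plane y (Y y)) x →
        MDifferentiableAt (𝓡 2) 𝓘(ℝ, R22) (fun y ↦ diff F y (Y y)) x ∧
        ∀ X : TangentSpace (𝓡 2) x, diff (fun y ↦ diff F y (Y y)) x X =
          diff F x (covM Y x X) + Φ x (B X (Y x)) := by
    intro U s t hs ht x hx
    obtain ⟨B, hsymm, hB, hBr⟩ := hφ.exists_bilinear hφ₁ hs ht hx
    refine ⟨B, hBr, fun Y hY => ?_⟩
    have heq : (fun y ↦ diff F y (Y y)) = fun y => toR22L (φ.xi (s y) (t y) 0 (Y y)) :=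
      funext fun y => diff_eq y _ _ _
    obtain ⟨d, e⟩ := φ.vderiv_xi hcovE hcovM.1 hs ht hx (ν := fun _ => 0)
      (zero_smooth.contMDiffAt.mdifferentiableAt (by simp)) hY
    obtain ⟨d', e'⟩ := vderiv_clm toR22L d
    rw [heq]
    refine ⟨d', fun X => (e' X).trans ?_⟩
    have hz : covE (fun _ => 0) x X = 0 := by
      have := congrFun covE.zero x
      exact congrArg (fun l => l X) this
    -- Differentiating dF(Y) along X produces Y · ∇_X φ, that is B(Y, X); the symmetry of B restores
    -- the order.
    rw [e, hz, sub_eq_add_neg, hB, map_add, ← diff_eq, ← Φ_eq, hsymm]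
  refine ⟨⟨F_smooth, fun x => ⟨fun X Y hXY => ?_, F_isom x⟩⟩, Φ, Φ_emb, ?_, ?_, Φ_isom, ?_, ?_⟩
  · obtain ⟨q⟩ := hM x
    exact (SM.frame_positive q).ext (by rw [← F_isom, hXY, F_isom]) (by rw [← F_isom, hXY, F_isom])
  · intro U₀ ν hU₀ hν x hx
    obtain ⟨U, s, t, hxU, hs, ht⟩ := local_frames x
    have h₁ := contMDiffOn_clm toR22L (φ.contMDiffOn_xi hs ht (W := U₀ ∩ U) Set.inter_subset_right
      (hν.mono Set.inter_subset_left) zero_smooth'.contMDiffOn)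
    have h₂ := h₁.congr fun y _ => Φ_eq y (s y) (t y) (ν y)
    exact ((h₂ x ⟨hx, hxU⟩).contMDiffAt
      ((hU₀.inter hs.isOpen).mem_nhds ⟨hx, hxU⟩)).contMDiffWithinAt
  · intro x
    exact ⟨fun ν _ => Φ_normal x ν, (Φ_inj x).injOn, fun w hw =>
      let ⟨ν, hν⟩ := Φ_surj x w hw
      ⟨ν, trivial, hν⟩⟩
  · intro ν x hν
    obtain ⟨U, s, t, hx, hs, ht⟩ := local_frames x
    have heq : (fun y ↦ Φ y (ν y)) = fun y => toR22L (φ.xi (s y) (t y) (ν y) 0) :=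
      funext fun y => Φ_eq y _ _ _
    obtain ⟨d, e⟩ := φ.vderiv_xi hcovE hcovM.1 hs ht hx (Y := fun _ => 0) hν
      (zero_smooth'.contMDiffAt.mdifferentiableAt (by simp))
    obtain ⟨d', e'⟩ := vderiv_clm toR22L d
    rw [heq]
    refine ⟨d', fun X => ⟨Φ_normal x _, ?_⟩⟩
    obtain ⟨W, hW⟩ := hφ.exists_tangent hφ₁ hs ht hx (ν x) X
    refine ⟨W, (e' X).trans ?_⟩
    have hz : covM (fun _ => 0) x X = 0 := by
      have := congrFun covM.zero x
      exact congrArg (fun l => l X) this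
    rw [e, hz, sub_eq_add_neg, hW, map_add, ← diff_eq, ← Φ_eq, add_comm]
  · choose U s t hx hs ht using local_frames
    choose B hBr hB using fun x => deriv_dF (U x) (s x) (t x) (hs x) (ht x) x (hx x)
    refine ⟨B, ?_, fun Y x hY => hB x Y hY⟩
    intro U' s' t' hs' ht' x hx' X Z ν
    obtain ⟨B', hBr', hB'⟩ := deriv_dF U' s' t' hs' ht' x hx'
    -- B was built in a chosen frame at each point and must satisfy its definition in every frame.
    -- Its image under the injective Φ is fixed by the derivative of dF along an extension of Z,
    -- where no spinorial frame enters, so the values in the two frames agree.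
    have hY := FiberBundle.mdifferentiableAt_extend (𝓡 2) Plane Z
    have h₁ := ((hB x _ hY).2 X).symm.trans ((hB' _ hY).2 X)
    have h₂ := Φ_inj x (add_left_cancel h₁)
    rw [FiberBundle.extend_apply_self] at h₂
    rw [h₂, hBr']
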